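/- For $n\ge 1$ and $\theta\in\mathbb R$ let $\mathbf a_n(\theta)=(1,z,\dots,z^{n-1})^{\mathrm T}\in\mathbb C^n$ with $z=e^{2\pi i\sin\theta}$, and for $\boldsymbol\theta=(\theta_x,\theta_y)$ let $\mathbf A(\boldsymbol\theta)=\mathbf a_N(\theta_x)\,\mathbf a_M(\theta_y)^{\mathrm H}\in\mathbb C^{N\times M}$. The atomic norm of $\mathbf X\in\mathbb C^{N\times M}$ is $$\|\mathbf X\|_{\mathcal A}=\inf\Big\{\sum_k|s_k| \;:\; \mathbf X=\sum_k s_k\mathbf A(\boldsymbol\theta_k)\Big\},$$ the infimum being over all finite decompositions with $s_k\in\mathbb C$ and $\boldsymbol\theta_k\in[0,2\pi]^2$; a decomposition is optimal if it attains this infimum. For $\mathbf u\in\mathbb C^n$ let $\mathbf T(\mathbf u)$ be the Hermitian Toeplitz matrix with first row $\mathbf u$. Theorem. Let $N,M\ge 1$, $K\ge 0$, and let $\mathbf X=\sum_{k=1}^K s_k^\star\,\mathbf A(\boldsymbol\theta_k^\star)$ with $s_k^\star\in\mathbb C$ and $\boldsymbol\theta_k^\star=(\theta_{x,k}^\star,\theta_{y,k}^\star)\in[0,2\pi]^2$.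 Put $$\Delta_{\min,x}=\min_{i\ne j}|\sin\theta_{x,i}^\star-\sin\theta_{x,j}^\star|,\qquad \Delta_{\min,y}=\min_{i\ne j}|\sin\theta_{y,i}^\star-\sin\theta_{y,j}^\star|,$$ where $|a-b|$ denotes the wrapped distance on the circle $\mathbb R/\mathbb Z$, that is, the distance of $a-b$ to the nearest integer, and the minimum is $+\infty$ if $K\le 1$. Suppose that $$\Delta_{\min,x}\ge\frac{1.19}{\lfloor (N-1)/4\rfloor},\qquad \Delta_{\min,y}\ge\frac{1.19}{\lfloor (M-1)/4\rfloor},$$ where $1.19/0=+\infty$. Then: 1. The decomposition $\mathbf X=\sum_{k} s_k^\star\mathbf A(\boldsymbol\theta_k^\star)$ is optimal, that is, $\|\mathbf X\|_{\mathcal A}=\sum_k|s_k^\star|$. 2. It is the only optimal decomposition: if $\mathbf X=\sum_{l} c_l\mathbf A(\boldsymbol\varphi_l)$ is optimal, then for every $l$ with $c_l\ne 0$ the atom $\mathbf A(\boldsymbol\varphi_l)$ equals some $\mathbf A(\boldsymbol\theta_k^\star)$ with $s_k^\star\neq 0$, and for every $k$ the sum of the $c_l$ over all $l$ with $\mathbf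 A(\boldsymbol\varphi_l)=\mathbf A(\boldsymbol\theta_k^\star)$ is $s_k^\star$. 3. The atomic norm is the value, attained, of a semidefinite program of size $(N+M)\times(N+M)$: $$\|\mathbf X\|_{\mathcal A}=\min_{\mathbf u_x\in\mathbb C^N,\ \mathbf u_y\in\mathbb C^M}\ \frac{1}{2\sqrt{NM}}\Big(\operatorname{tr}\mathbf T(\mathbf u_x)+\operatorname{tr}\mathbf T(\mathbf u_y)\Big)\quad\text{s.t.}\quad\begin{pmatrix}\mathbf T(\mathbf u_y)&\mathbf X^{\mathrm H}\\ \mathbf X&\mathbf T(\mathbf u_x)\end{pmatrix}\succeq 0 .$$ -/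

import Mathlib

open scoped ENNReal ComplexOrder

namespace DecoupledANM

/-- The array response vector of length `n`: the Vandermonde vector
`(1, z, z², …, z ^ (n-1))` with `z = exp (2 π i sin θ)`. The sine of the angle is the
(normalized) frequency, a point of the circle `ℝ / ℤ`. -/
noncomputable def arrayResponse (n : ℕ) (θ : ℝ) : Fin n → ℂ :=
  fun j => Complex.exp (2 * Real.pi * Complex.I * (Real.sin θ : ℂ) * ((j : ℕ) : ℂ))

/-- The rank-one matrix `A(θ) = a_N(θ_x) a_M(θ_y)ᴴ`, for `θ = (θ_x, θ_y)`. -/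
noncomputable def atom (N M : ℕ) (θ : ℝ × ℝ) : Matrix (Fin N) (Fin M) ℂ :=
  Matrix.vecMulVec (arrayResponse N θ.1) (star (arrayResponse M θ.2))

/-- The square `[0, 2π] × [0, 2π]` of admissible pairs of angles. -/
def angles : Set (ℝ × ℝ) :=
  Set.Icc 0 (2 * Real.pi) ×ˢ Set.Icc 0 (2 * Real.pi)

/-- `X = ∑ k, s k • A(θ k)`, a finite sum over admissible pairs of angles: a feasible point of
the problem that defines the atomic norm of `X`. -/
def IsDecomposition {N M K : ℕ} (X : Matrix (Fin N) (Fin M) ℂ) (s : Fin K → ℂ)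
    (θ : Fin K → ℝ × ℝ) : Prop :=
  (∀ k, θ k ∈ angles) ∧ X = ∑ k, s k • atom N M (θ k)

/-- The cost `∑ k, |s k|` of a decomposition with coefficients `s`. -/
noncomputable def cost {K : ℕ} (s : Fin K → ℂ) : ℝ := ∑ k, ‖s k‖

/-- The atomic norm: the infimum of the costs of all finite decompositions. -/
noncomputable def atomicNorm {N M : ℕ} (X : Matrix (Fin N) (Fin M) ℂ) : ℝ :=
  sInf {r : ℝ | ∃ (K : ℕ) (s : Fin K → ℂ) (θ : Fin K → ℝ × ℝ),
    IsDecomposition X s θ ∧ r = cost s}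

/-- A decomposition of `X` that attains the atomic norm. -/
def IsOptimalDecomposition {N M K : ℕ} (X : Matrix (Fin N) (Fin M) ℂ) (s : Fin K → ℂ)
    (θ : Fin K → ℝ × ℝ) : Prop :=
  IsDecomposition X s θ ∧ cost s = atomicNorm X

open Classical in
/-- The total coefficient that a decomposition `(s, θ)` gives to the matrix `B`: the sum of the
`s k` over all `k` with `A(θ k) = B`. -/
noncomputable def coefficientAt {N M K : ℕ} (s : Fin K → ℂ) (θ : Fin K → ℝ × ℝ)
    (B : Matrix (Fin N) (Fin M) ℂ) : ℂ :=
  ∑ k, if atom N M (θ k) = B then s k else 0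

/-- The wrapped distance of two reals on the circle `ℝ / ℤ` of circumference one. -/
noncomputable def wrappedDist (x y : ℝ) : ℝ := ‖((x - y : ℝ) : UnitAddCircle)‖

/-- The minimal wrapped distance of the sines of the angles `θ i`; it is `∞` if there are
fewer than two angles. -/
noncomputable def minSeparation {K : ℕ} (θ : Fin K → ℝ) : ℝ≥0∞ :=
  ⨅ (i : Fin K) (j : Fin K) (_ : i ≠ j),
    ENNReal.ofReal (wrappedDist (Real.sin (θ i)) (Real.sin (θ j)))

/-- The threshold `1.19 / ⌊(n - 1) / 4⌋`; it is `∞` for `n ≤ 4`. -/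
noncomputable def separationThreshold (n : ℕ) : ℝ≥0∞ :=
  ENNReal.ofReal 1.19 / (((n - 1) / 4 : ℕ) : ℝ≥0∞)

/-- The Toeplitz matrix with first row `u` whose entries below the diagonal are the conjugates
of those above it (it is Hermitian exactly when its diagonal is real). -/
def toeplitz {n : ℕ} (u : Fin n → ℂ) : Matrix (Fin n) (Fin n) ℂ :=
  Matrix.of fun i j =>
    if i ≤ j then u ⟨(j : ℕ) - i, lt_of_le_of_lt (Nat.sub_le _ _) j.isLt⟩
    else star (u ⟨(i : ℕ) - j, lt_of_le_of_lt (Nat.sub_le _ _) i.isLt⟩)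

/-- Feasibility in the semidefinite program: the `(M + N) × (M + N)` block matrix
`[T(u_y), Xᴴ; X, T(u_x)]` is (Hermitian) positive semidefinite. -/
def SDPFeasible {N M : ℕ} (X : Matrix (Fin N) (Fin M) ℂ) (ux : Fin N → ℂ) (uy : Fin M → ℂ) :
    Prop :=
  (Matrix.fromBlocks (toeplitz uy) X.conjTranspose X (toeplitz ux)).PosSemidef

/-- The objective `(tr T(u_x) + tr T(u_y)) / (2 √(N M))`; both traces are real at every
feasible point. -/
noncomputable def sdpObjective {N M : ℕ} (ux : Fin N → ℂ) (uy : Fin M → ℂ) : ℝ :=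
  1 / (2 * Real.sqrt ((N : ℝ) * (M : ℝ))) *
    ((toeplitz ux).trace.re + (toeplitz uy).trace.re)

end DecoupledANM

/-!
Duality. From squared Fejér kernels and their derivatives one builds, for nodes separated by
`1.19 / ⌊(n - 1) / 4⌋`, trigonometric polynomials `P k` of degree less than `n` that interpolate
the Kronecker delta at the nodes and satisfy `∑ k, |P k| ^ 2 ≤ 1`, with equality only at the nodes.
Let `P k` and `R k` be these polynomials for the two coordinates of the angles. For unimodular
`v k` with `v k * s k = |s k|`, the function `∑ k, v k * P k (x) * conj (R k (y))` has, by
AM-GM, modulus at most one, with equality only at the given pairs of angles. Pairing it with a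
decomposition of `X` bounds the cost from below by `∑ k, |s k|`, and the equality case gives
uniqueness.

For the semidefinite program, `1 - ∑ k, |P k| ^ 2` is a sum of squares of polynomials by the
Fejér–Riesz theorem, so that a positive semidefinite Toeplitz matrix `T` satisfies
`∑ k, p k ⬝ᵥ T *ᵥ conj (p k) ≤ T 0 0` for the coefficient vectors `p k` of `P k`. Applied to both
diagonal blocks, together with positivity of the block matrix on the vectors formed from `p k` and
`r k`, this bounds the objective from below by `∑ k, |s k|`. The bound is attained by
the conjugates of combinations of the array responses with weights proportional to `|s k|`.
-/

namespace DecoupledANM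

open Finset Real

/-! ### Averages over the difference frequencies -/

/-- The average of `φ (2 (j - k) / L)` over `j, k < L`. Squared Dirichlet kernels and their
derivatives are such averages; the frequencies are scaled to lie in `[-2, 2]`. -/
noncomputable def freqAvg (L : ℕ) (φ : ℝ → ℝ) : ℝ :=
  (∑ j ∈ range L, ∑ k ∈ range L, φ (2 * ((j : ℝ) - k) / L)) / (L : ℝ) ^ 2

theorem hasDerivAt_freqAvg (L : ℕ) {φ φ' : ℝ → ℝ → ℝ} {u : ℝ}
    (h : ∀ ν, HasDerivAt (fun u => φ u ν) (φ' u ν) u) :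
    HasDerivAt (fun u => freqAvg L (φ u)) (freqAvg L (φ' u)) u :=
  (HasDerivAt.fun_sum fun _ _ => HasDerivAt.fun_sum fun _ _ => h _).div_const _

theorem freqAvg_congr {L : ℕ} {φ ψ : ℝ → ℝ}
    (h : ∀ j < L, ∀ k < L, φ (2 * ((j : ℝ) - k) / L) = ψ (2 * ((j : ℝ) - k) / L)) :
    freqAvg L φ = freqAvg L ψ := by
  unfold freqAvg
  congr 1
  exact sum_congr rfl fun j hj => sum_congr rfl fun k hk =>
    h j (mem_range.1 hj) k (mem_range.1 hk)

theorem abs_two_mul_sub_div_le {L j k : ℕ} (hj : j < L) (hk : k < L) :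
    |2 * ((j : ℝ) - k) / L| ≤ 2 := by
  have hL : (0 : ℝ) < L := by exact_mod_cast j.zero_le.trans_lt hj
  have hj' : (j : ℝ) < L := by exact_mod_cast hj
  have hk' : (k : ℝ) < L := by exact_mod_cast hk
  rw [abs_div, abs_of_pos hL, div_le_iff₀ hL, abs_mul, abs_two]
  gcongr
  rw [abs_le]
  constructor <;> linarith [Nat.cast_nonneg (α := ℝ) j, Nat.cast_nonneg (α := ℝ) k]

theorem freqAvg_mono {L : ℕ} {φ ψ : ℝ → ℝ} (h : ∀ ν, |ν| ≤ 2 → φ ν ≤ ψ ν) :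
    freqAvg L φ ≤ freqAvg L ψ := by
  unfold freqAvg
  gcongr with j hj k hk
  exact h _ (abs_two_mul_sub_div_le (mem_range.1 hj) (mem_range.1 hk))

theorem abs_freqAvg_le (L : ℕ) (φ : ℝ → ℝ) : |freqAvg L φ| ≤ freqAvg L fun ν => |φ ν| := by
  unfold freqAvg
  rw [abs_div, abs_of_nonneg (by positivity : (0 : ℝ) ≤ (L : ℝ) ^ 2)]
  gcongr
  exact (abs_sum_le_sum_abs _ _).trans (sum_le_sum fun _ _ => abs_sum_le_sum_abs _ _)

theorem freqAvg_const_mul (L : ℕ) (c : ℝ) (φ : ℝ → ℝ) :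
    freqAvg L (fun ν => c * φ ν) = c * freqAvg L φ := by
  simp only [freqAvg, ← mul_sum, mul_div_assoc]

theorem freqAvg_add (L : ℕ) (φ ψ : ℝ → ℝ) :
    freqAvg L (fun ν => φ ν + ψ ν) = freqAvg L φ + freqAvg L ψ := by
  simp only [freqAvg, sum_add_distrib, add_div]

theorem freqAvg_const {L : ℕ} (hL : 0 < L) (c : ℝ) : freqAvg L (fun _ => c) = c := by
  have hL₀ : (L : ℝ) ≠ 0 := by positivity
  simp only [freqAvg, sum_const, card_range, nsmul_eq_mul]
  field_simp

theorem sum_range_natCast (n : ℕ) : ∑ j ∈ range n, (j : ℝ) = n * (n - 1) / 2 := by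
  induction n with
  | zero => simp
  | succ n ih => rw [sum_range_succ, ih]; push_cast; ring

theorem sum_range_natCast_sq (n : ℕ) :
    ∑ j ∈ range n, (j : ℝ) ^ 2 = n * (n - 1) * (2 * n - 1) / 6 := by
  induction n with
  | zero => simp
  | succ n ih => rw [sum_range_succ, ih]; push_cast; ring

theorem freqAvg_sq {L : ℕ} (hL : 0 < L) :
    freqAvg L (fun ν => ν ^ 2) = 2 / 3 * (1 - 1 / (L : ℝ) ^ 2) := by
  have hL₀ : (L : ℝ) ≠ 0 := by positivity
  have expand (j k : ℕ) : (2 * ((j : ℝ) - k) / L) ^ 2 =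
      4 / (L : ℝ) ^ 2 * ((j : ℝ) ^ 2 + (k : ℝ) ^ 2 - 2 * j * k) := by
    field_simp
    ring
  simp only [freqAvg, expand, sum_sub_distrib, sum_add_distrib, ← mul_sum, ← sum_mul, sum_const,
    card_range, nsmul_eq_mul, sum_range_natCast, sum_range_natCast_sq]
  field_simp
  ring

theorem freqAvg_sq_le {L : ℕ} (hL : 0 < L) : freqAvg L (fun ν => ν ^ 2) ≤ 2 / 3 := by
  rw [freqAvg_sq hL]
  have : 0 ≤ 1 / (L : ℝ) ^ 2 := by positivity
  linarith

/-! ### The Fejér kernel and its derivatives -/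

/-- The `n`-th derivative of the Fejér kernel `|∑ j < L, exp (2 i j u / L)|² / L²`, which has period
`π L` and equals `1` at `0`. Treating all derivatives as one family is possible because
differentiating a cosine shifts its phase by `π / 2`. -/
noncomputable def fejer (L n : ℕ) (u : ℝ) : ℝ :=
  freqAvg L fun ν => ν ^ n * cos (ν * u + n * (π / 2))

theorem hasDerivAt_fejer (L n : ℕ) (u : ℝ) : HasDerivAt (fejer L n) (fejer L (n + 1) u) u := by
  refine hasDerivAt_freqAvg L (φ := fun u ν => ν ^ n * cos (ν * u + n * (π / 2)))
    (φ' := fun u ν => ν ^ (n + 1) * cos (ν * u + (n + 1 : ℕ) * (π / 2))) fun ν => ?_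
  refine ((((hasDerivAt_id u).const_mul ν).add_const _).cos.const_mul _).congr_deriv ?_
  rw [Nat.cast_succ, add_one_mul, ← add_assoc, cos_add_pi_div_two, id]
  ring

theorem fejer_neg (L n : ℕ) (u : ℝ) : fejer L n (-u) = (-1) ^ n * fejer L n u := by
  rw [fejer, fejer, ← freqAvg_const_mul]
  refine freqAvg_congr fun j _ k _ => ?_
  rw [← cos_neg, show -(2 * ((j : ℝ) - k) / L * -u + n * (π / 2)) =
    2 * ((j : ℝ) - k) / L * u + n * (π / 2) - n * π by ring, cos_sub_nat_mul_pi]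
  ring

theorem fejer_periodic (L n : ℕ) : Function.Periodic (fejer L n) (π * L) := by
  refine fun u => freqAvg_congr fun j hj k _ => ?_
  have hL : (L : ℝ) ≠ 0 := by exact_mod_cast (j.zero_le.trans_lt hj).ne'
  rw [show 2 * ((j : ℝ) - k) / L * (u + π * L) + n * (π / 2) =
    2 * ((j : ℝ) - k) / L * u + n * (π / 2) + ((j - k : ℤ) : ℝ) * (2 * π) by
      push_cast; field_simp; ring, cos_add_int_mul_two_pi]

theorem fejer_zero_zero {L : ℕ} (hL : 0 < L) : fejer L 0 0 = 1 := by
  simp [fejer, freqAvg_const hL]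

theorem fejer_one_zero (L : ℕ) : fejer L 1 0 = 0 := by
  simp [fejer, freqAvg]

theorem fejer_two_zero_le {L : ℕ} (hL : 7 ≤ L) : fejer L 2 0 ≤ -(653 / 1000) := by
  have h : fejer L 2 0 = -1 * freqAvg L (fun ν => ν ^ 2) := by
    rw [← freqAvg_const_mul]
    simp [fejer, mul_div_cancel₀]
  rw [h, freqAvg_sq (by omega)]
  have hL' : (7 : ℝ) ≤ L := by exact_mod_cast hL
  have : 1 / (L : ℝ) ^ 2 ≤ 1 / 7 ^ 2 := by gcongr
  norm_num at this ⊢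
  linarith

theorem abs_fejer_le (L n : ℕ) (u : ℝ) : |fejer L n u| ≤ freqAvg L fun ν => |ν| ^ n := by
  refine (abs_freqAvg_le L _).trans (freqAvg_mono fun ν _ => ?_)
  rw [abs_mul, abs_pow]
  exact mul_le_of_le_one_right (by positivity) (abs_cos_le_one _)

theorem abs_fejer_one_le {L : ℕ} (hL : 0 < L) (u : ℝ) : |fejer L 1 u| ≤ 5 / 6 := by
  have h : freqAvg L (fun ν => |ν| ^ 1) ≤ freqAvg L fun ν => 1 / 2 * ν ^ 2 + 1 / 2 :=
    freqAvg_mono fun ν _ => by nlinarith [sq_nonneg (|ν| - 1), sq_abs ν]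
  rw [freqAvg_add, freqAvg_const_mul, freqAvg_const hL] at h
  linarith [abs_fejer_le L 1 u, freqAvg_sq_le hL]

theorem abs_fejer_two_le {L : ℕ} (hL : 0 < L) (u : ℝ) : |fejer L 2 u| ≤ 2 / 3 := by
  simpa only [sq_abs] using (abs_fejer_le L 2 u).trans (by simpa using freqAvg_sq_le hL)

theorem abs_fejer_three_le {L : ℕ} (hL : 0 < L) (u : ℝ) : |fejer L 3 u| ≤ 4 / 3 := by
  have h : freqAvg L (fun ν => |ν| ^ 3) ≤ freqAvg L fun ν => 2 * ν ^ 2 := by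
    refine freqAvg_mono fun ν hν => ?_
    rw [pow_succ', sq_abs]
    gcongr
  rw [freqAvg_const_mul] at h
  linarith [abs_fejer_le L 3 u, freqAvg_sq_le hL]

theorem norm_le_mul_abs_of_hasDerivAt {E : Type*} [NormedAddCommGroup E] [NormedSpace ℝ E]
    {f f' : ℝ → E} {C a t : ℝ} (h0 : f 0 = 0) (hf : ∀ t, HasDerivAt f (f' t) t)
    (hC : ∀ t, |t| ≤ a → ‖f' t‖ ≤ C) (ht : |t| ≤ a) : ‖f t‖ ≤ C * |t| := by
  simpa [h0] using (convex_Icc (-a) a).norm_image_sub_le_of_norm_hasDerivWithin_le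
    (fun x _ => (hf x).hasDerivWithinAt) (fun x hx => hC x (abs_le.2 hx))
    (abs_le.1 (abs_zero.trans_le ((abs_nonneg t).trans ht))) (abs_le.1 ht)

theorem abs_fejer_one_le_mul {L : ℕ} (hL : 0 < L) (u : ℝ) : |fejer L 1 u| ≤ 2 / 3 * |u| :=
  norm_le_mul_abs_of_hasDerivAt (fejer_one_zero L) (hasDerivAt_fejer L 1)
    (fun t _ => abs_fejer_two_le hL t) le_rfl

/-! ### Decay of the Fejér kernel -/

theorem sin_mul_sum_cos (n : ℕ) (w : ℝ) :
    sin w * ∑ j ∈ range n, cos (2 * j * w) = sin (n * w) * cos ((n - 1) * w) := by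
  induction n with
  | zero => simp
  | succ n ih =>
    rw [sum_range_succ, mul_add, ih, Nat.cast_succ, add_sub_cancel_right, add_one_mul, sub_one_mul,
      mul_assoc, two_mul, sin_add, cos_sub, cos_add]
    ring

theorem sin_mul_sum_sin (n : ℕ) (w : ℝ) :
    sin w * ∑ j ∈ range n, sin (2 * j * w) = sin (n * w) * sin ((n - 1) * w) := by
  induction n with
  | zero => simp
  | succ n ih =>
    rw [sum_range_succ, mul_add, ih, Nat.cast_succ, add_sub_cancel_right, add_one_mul, sub_one_mul,
      mul_assoc, two_mul, sin_add, sin_sub, sin_add]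
    ring

theorem fejer_zero_eq_sq_add_sq (L : ℕ) (u : ℝ) :
    fejer L 0 u = ((∑ j ∈ range L, cos (2 * j * (u / L))) ^ 2 +
      (∑ j ∈ range L, sin (2 * j * (u / L))) ^ 2) / (L : ℝ) ^ 2 := by
  simp only [fejer, freqAvg, sq, sum_mul_sum, ← sum_add_distrib, ← cos_sub]
  congr 1
  refine sum_congr rfl fun j _ => sum_congr rfl fun k _ => ?_
  ring_nf

theorem fejer_zero_nonneg (L : ℕ) (u : ℝ) : 0 ≤ fejer L 0 u := by
  rw [fejer_zero_eq_sq_add_sq]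
  positivity

theorem sin_sq_mul_fejer_zero {L : ℕ} (hL : 0 < L) (u : ℝ) :
    (L * sin (u / L)) ^ 2 * fejer L 0 u = sin u ^ 2 := by
  have hL₀ : (L : ℝ) ≠ 0 := by positivity
  have hcos := sin_mul_sum_cos L (u / L)
  have hsin := sin_mul_sum_sin L (u / L)
  rw [mul_div_cancel₀ u hL₀] at hcos hsin
  rw [fejer_zero_eq_sq_add_sq, mul_pow, mul_div_assoc', mul_assoc,
    mul_div_cancel_left₀ _ (by positivity), mul_add, ← mul_pow, ← mul_pow, hcos, hsin]
  linear_combination sin u ^ 2 * sin_sq_add_cos_sq ((L - 1) * (u / L))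

theorem hasDerivAt_mul_sin_div {L : ℝ} (hL : L ≠ 0) (u : ℝ) :
    HasDerivAt (fun u => L * sin (u / L)) (cos (u / L)) u :=
  (((hasDerivAt_id u).div_const L).sin.const_mul L).congr_deriv (by simp; field_simp)

theorem hasDerivAt_cos_div (L u : ℝ) :
    HasDerivAt (fun u => cos (u / L)) (-(sin (u / L) / L)) u :=
  ((hasDerivAt_id u).div_const L).cos.congr_deriv (by simp; ring)

theorem sin_sq_mul_fejer_one {L : ℕ} (hL : 0 < L) (u : ℝ) :
    (L * sin (u / L)) ^ 2 * fejer L 1 u + 2 * (L * sin (u / L)) * cos (u / L) * fejer L 0 u =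
      sin (2 * u) := by
  have hL₀ : (L : ℝ) ≠ 0 := by positivity
  have hleft := ((hasDerivAt_mul_sin_div hL₀ u).fun_pow 2).fun_mul (hasDerivAt_fejer L 0 u)
  have hright := (hasDerivAt_sin u).fun_pow 2
  rw [funext (sin_sq_mul_fejer_zero hL)] at hleft
  linear_combination hleft.unique hright - sin_two_mul u

theorem sin_sq_mul_fejer_two {L : ℕ} (hL : 0 < L) (u : ℝ) :
    (L * sin (u / L)) ^ 2 * fejer L 2 u + 4 * (L * sin (u / L)) * cos (u / L) * fejer L 1 u +
      2 * cos (2 * (u / L)) * fejer L 0 u = 2 * cos (2 * u) := by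
  have hL₀ : (L : ℝ) ≠ 0 := by positivity
  have hleft := (((hasDerivAt_mul_sin_div hL₀ u).fun_pow 2).fun_mul
    (hasDerivAt_fejer L 1 u)).fun_add ((((hasDerivAt_mul_sin_div hL₀ u).const_mul 2).fun_mul
      (hasDerivAt_cos_div L u)).fun_mul (hasDerivAt_fejer L 0 u))
  have hright := ((hasDerivAt_id u).const_mul 2).sin
  rw [funext (sin_sq_mul_fejer_one hL)] at hleft
  have h := hleft.unique hright
  rw [cos_two_mul' (u / L)]
  simp only [Nat.cast_ofNat, Nat.add_one_sub_one, pow_one, Nat.reduceAdd, mul_neg, zero_add, id_eq,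
    mul_one] at h
  field_simp at h ⊢
  linear_combination h

theorem exists_abs_eq_norm_coe {α : Type*} {f : ℝ → α} {T : ℝ} (hf : Function.Periodic f T)
    (u : ℝ) : ∃ v : ℝ, |v| = ‖(u : AddCircle T)‖ ∧ f v = f u :=
  ⟨u - round (T⁻¹ * u) * T, (AddCircle.norm_eq T).symm, hf.sub_int_mul_eq _⟩

/-- The square root of the denominator of the Fejér kernel: `L / 2` times the chord between `1` and
`exp (2 i u / L)` on the unit circle. -/
noncomputable def chord (L : ℕ) (u : ℝ) : ℝ := L * |sin (u / L)|

theorem chord_sq (L : ℕ) (u : ℝ) : chord L u ^ 2 = (L * sin (u / L)) ^ 2 := by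
  rw [chord, mul_pow, sq_abs, mul_pow]

theorem chord_periodic {L : ℕ} (hL : 0 < L) : Function.Periodic (chord L) (π * L) := fun u => by
  have hL₀ : (L : ℝ) ≠ 0 := by positivity
  rw [chord, add_div, mul_div_cancel_right₀ _ hL₀, sin_add_pi, abs_neg, chord]

theorem two_div_pi_mul_norm_le_chord {L : ℕ} (hL : 0 < L) (u : ℝ) :
    2 / π * ‖(u : AddCircle (π * L))‖ ≤ chord L u := by
  have hL₀ : (0 : ℝ) < L := by positivity
  obtain ⟨v, hv, hvu⟩ := exists_abs_eq_norm_coe (chord_periodic hL) u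
  rw [← hvu, ← hv]
  have hv_le : |v / L| ≤ π / 2 := by
    rw [abs_div, abs_of_pos hL₀, div_le_iff₀ hL₀, hv]
    refine (AddCircle.norm_le_half_period _ (by positivity)).trans_eq ?_
    rw [abs_of_pos (by positivity)]
    ring
  calc 2 / π * |v| = L * (2 / π * |v / L|) := by
        rw [abs_div, abs_of_pos hL₀]
        field_simp
    _ ≤ L * |sin (v / L)| := by gcongr; exact mul_abs_le_abs_sin hv_le

theorem le_chord_of_le_norm {L : ℕ} (hL : 0 < L) {x κ : ℝ}
    (hx : π / 2 * κ ≤ ‖(x : AddCircle (π * L))‖) : κ ≤ chord L x := by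
  refine le_trans ?_ (two_div_pi_mul_norm_le_chord hL x)
  calc κ = 2 / π * (π / 2 * κ) := by field_simp
    _ ≤ 2 / π * ‖(x : AddCircle (π * L))‖ := by gcongr

theorem fejer_zero_le_chord {L : ℕ} (hL : 0 < L) {u : ℝ} (hu : 0 < chord L u) :
    fejer L 0 u ≤ 1 / chord L u ^ 2 := by
  rw [le_div_iff₀ (by positivity), mul_comm, chord_sq, sin_sq_mul_fejer_zero hL]
  exact sin_sq_le_one u

theorem chord_sq_mul_abs_fejer_one_le {L : ℕ} (hL : 0 < L) (u : ℝ) :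
    chord L u ^ 2 * |fejer L 1 u| ≤ 1 + 2 * chord L u * fejer L 0 u := by
  calc chord L u ^ 2 * |fejer L 1 u|
      = |sin (2 * u) - 2 * (L * sin (u / L)) * cos (u / L) * fejer L 0 u| := by
        rw [← sin_sq_mul_fejer_one hL, chord_sq, add_sub_cancel_right, abs_mul, abs_sq]
    _ ≤ |sin (2 * u)| + |2 * (L * sin (u / L)) * cos (u / L) * fejer L 0 u| := abs_sub _ _
    _ = |sin (2 * u)| + 2 * chord L u * |cos (u / L)| * fejer L 0 u := by
        simp only [abs_mul, abs_two, Nat.abs_cast, abs_of_nonneg (fejer_zero_nonneg L u), chord]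
    _ ≤ 1 + 2 * chord L u * 1 * fejer L 0 u := by
        have hF := fejer_zero_nonneg L u
        have hchord : 0 ≤ chord L u := by unfold chord; positivity
        gcongr
        exacts [abs_sin_le_one _, abs_cos_le_one _]
    _ = 1 + 2 * chord L u * fejer L 0 u := by rw [mul_one]

theorem abs_fejer_one_le_chord {L : ℕ} (hL : 0 < L) {u κ : ℝ} (hκ : 0 < κ) (hu : κ ≤ chord L u) :
    |fejer L 1 u| ≤ (1 + 2 / κ) * (1 / chord L u ^ 2) := by
  have hchord : 0 < chord L u := hκ.trans_le hu
  rw [mul_one_div, le_div_iff₀ (by positivity), mul_comm]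
  calc chord L u ^ 2 * |fejer L 1 u| ≤ 1 + 2 * chord L u * fejer L 0 u :=
        chord_sq_mul_abs_fejer_one_le hL u
    _ ≤ 1 + 2 * chord L u * (1 / chord L u ^ 2) := by
        gcongr
        exact fejer_zero_le_chord hL hchord
    _ = 1 + 2 / chord L u := by field_simp
    _ ≤ 1 + 2 / κ := by gcongr

theorem chord_sq_mul_abs_fejer_two_le {L : ℕ} (hL : 0 < L) (u : ℝ) :
    chord L u ^ 2 * |fejer L 2 u| ≤
      2 + 4 * chord L u * |fejer L 1 u| + 2 * fejer L 0 u := by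
  calc chord L u ^ 2 * |fejer L 2 u|
      = |2 * cos (2 * u) - 4 * (L * sin (u / L)) * cos (u / L) * fejer L 1 u -
          2 * cos (2 * (u / L)) * fejer L 0 u| := by
        rw [← sin_sq_mul_fejer_two hL, chord_sq, add_sub_right_comm, add_sub_cancel_right,
          add_sub_cancel_right, abs_mul, abs_sq]
    _ ≤ |2 * cos (2 * u)| + |4 * (L * sin (u / L)) * cos (u / L) * fejer L 1 u| +
          |2 * cos (2 * (u / L)) * fejer L 0 u| :=
        (abs_sub _ _).trans (add_le_add_left (abs_sub _ _) _)
    _ = 2 * |cos (2 * u)| + 4 * chord L u * |cos (u / L)| * |fejer L 1 u| +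
          2 * |cos (2 * (u / L))| * fejer L 0 u := by
        simp only [abs_mul, Nat.abs_cast, abs_of_nonneg (fejer_zero_nonneg L u), chord,
          Nat.abs_ofNat]
    _ ≤ 2 * 1 + 4 * chord L u * 1 * |fejer L 1 u| + 2 * 1 * fejer L 0 u := by
        have hF := fejer_zero_nonneg L u
        have hchord : 0 ≤ chord L u := by unfold chord; positivity
        gcongr <;> exact abs_cos_le_one _
    _ = 2 + 4 * chord L u * |fejer L 1 u| + 2 * fejer L 0 u := by ring

theorem abs_fejer_two_le_chord {L : ℕ} (hL : 0 < L) {u κ : ℝ} (hκ : 0 < κ) (hu : κ ≤ chord L u) :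
    |fejer L 2 u| ≤ (2 + 4 / κ + 10 / κ ^ 2) * (1 / chord L u ^ 2) := by
  have hchord : 0 < chord L u := hκ.trans_le hu
  rw [mul_one_div, le_div_iff₀ (by positivity), mul_comm]
  calc chord L u ^ 2 * |fejer L 2 u| ≤ 2 + 4 * chord L u * |fejer L 1 u| + 2 * fejer L 0 u :=
        chord_sq_mul_abs_fejer_two_le hL u
    _ ≤ 2 + 4 * chord L u * ((1 + 2 / κ) * (1 / chord L u ^ 2)) + 2 * (1 / chord L u ^ 2) := by
        gcongr
        exacts [abs_fejer_one_le_chord hL hκ hu, fejer_zero_le_chord hL hchord]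
    _ = 2 + 4 * (1 + 2 / κ) / chord L u + 2 / chord L u ^ 2 := by field_simp
    _ ≤ 2 + 4 * (1 + 2 / κ) / κ + 2 / κ ^ 2 := by gcongr
    _ = 2 + 4 / κ + 10 / κ ^ 2 := by field_simp; ring

theorem mul_le_chord {L : ℕ} (hL : 7 ≤ L) {u : ℝ} (hu : 0 ≤ u) :
    u * (1 - u ^ 2 / 294) ≤ chord L u := by
  have hL' : (7 : ℝ) ≤ L := by exact_mod_cast hL
  calc u * (1 - u ^ 2 / 294) = u - u ^ 3 / 6 * (1 / 7 ^ 2) := by ring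
    _ ≤ u - u ^ 3 / 6 * (1 / (L : ℝ) ^ 2) := by gcongr
    _ = L * (u / L - (u / L) ^ 3 / 6) := by field_simp
    _ ≤ L * sin (u / L) := by gcongr; exact sin_ge_sub_cube (by positivity)
    _ ≤ chord L u := by unfold chord; gcongr; exact le_abs_self _

theorem fejer_zero_le_sq_of_sin_le {L : ℕ} (hL : 7 ≤ L) {u d : ℝ} (hu : 0 < u) (hu2 : u ≤ 2)
    (h : sin u ≤ d * (u * (1 - u ^ 2 / 294))) : fejer L 0 u ≤ d ^ 2 := by
  have hsin : 0 < sin u := sin_pos_of_pos_of_lt_pi hu (hu2.trans_lt (by linarith [pi_gt_three]))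
  have hlower : 0 < u * (1 - u ^ 2 / 294) := mul_pos hu (by nlinarith)
  have hd : 0 < d := pos_of_mul_pos_left (hsin.trans_le h) hlower.le
  have hchord : 0 < chord L u := hlower.trans_le (mul_le_chord hL hu.le)
  have hsin_le : sin u ≤ chord L u * d := by
    rw [mul_comm]
    exact h.trans (by gcongr; exact mul_le_chord hL hu.le)
  refine le_of_mul_le_mul_left ?_ (by positivity : 0 < chord L u ^ 2)
  calc chord L u ^ 2 * fejer L 0 u = sin u ^ 2 := by
        rw [chord_sq, sin_sq_mul_fejer_zero (by omega)]
    _ ≤ chord L u ^ 2 * d ^ 2 := by rw [← mul_pow]; gcongr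

theorem fejer_zero_sq_le {L : ℕ} (hL : 7 ≤ L) {u : ℝ} (hu : |u| ≤ 1) :
    fejer L 0 u ^ 2 ≤ 1 - 48 / 100 * u ^ 2 := by
  wlog h0 : 0 ≤ u generalizing u
  · simpa [fejer_neg] using this (u := -u) (by rwa [abs_neg]) (by linarith)
  rcases h0.eq_or_lt with rfl | hu0
  · simp [fejer_zero_zero (by omega : 0 < L)]
  rw [abs_of_pos hu0] at hu
  have hu_sq : u ^ 2 ≤ 1 := by nlinarith
  have hsin : sin u ≤ u * (1 - u ^ 2 / 6 + (u ^ 2) ^ 2 / 100) := by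
    have := (abs_le.1 (sin_bound (x := u) (by rwa [abs_of_pos hu0]))).2
    rw [abs_of_pos hu0] at this
    nlinarith [sq_nonneg u]
  have hF : fejer L 0 u ≤ (1 - 153 / 1000 * u ^ 2) ^ 2 := by
    refine fejer_zero_le_sq_of_sin_le hL hu0 (by linarith) (hsin.trans ?_)
    rw [mul_left_comm]
    gcongr
    nlinarith [sq_nonneg u]
  calc fejer L 0 u ^ 2 ≤ ((1 - 153 / 1000 * u ^ 2) ^ 2) ^ 2 := by
        gcongr
        exact fejer_zero_nonneg L u
    _ ≤ (1 - 282 / 1000 * u ^ 2) ^ 2 := by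
        gcongr
        nlinarith [sq_nonneg u]
    _ ≤ 1 - 48 / 100 * u ^ 2 := by nlinarith [sq_nonneg u]

theorem sin_le_mul_of_mem_Icc {u : ℝ} (h1 : 1 ≤ u) (h2 : u ≤ 2) :
    sin u ≤ 847 / 1000 * (u * (1 - u ^ 2 / 294)) := by
  have hsin_one : 0 ≤ sin 1 := sin_nonneg_of_nonneg_of_le_pi zero_le_one (by linarith [pi_gt_three])
  have htangent : sin u ≤ sin 1 + 5 / 9 * (u - 1) := by
    calc sin u = sin 1 * cos (u - 1) + cos 1 * sin (u - 1) := by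
          rw [← sin_add, add_sub_cancel]
      _ ≤ sin 1 * 1 + 5 / 9 * (u - 1) := by
          gcongr
          · exact cos_le_one _
          · exact sin_nonneg_of_nonneg_of_le_pi (by linarith) (by linarith [pi_gt_three])
          · exact cos_one_le
          · exact sin_le (by linarith)
      _ = sin 1 + 5 / 9 * (u - 1) := by rw [mul_one]
  have hsin_one_le := (abs_le.1 (sin_bound (x := 1) (by norm_num))).2
  norm_num at hsin_one_le
  nlinarith [mul_nonneg (sub_nonneg.2 h1) (sub_nonneg.2 h2),
    mul_nonneg (mul_nonneg (sub_nonneg.2 h1) (sub_nonneg.2 h2)) (zero_le_one.trans h1)]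

theorem fejer_zero_le_of_one_le_norm {L : ℕ} (hL : 7 ≤ L) {u : ℝ}
    (hu : 1 ≤ ‖(u : AddCircle (π * L))‖) : fejer L 0 u ≤ 718 / 1000 := by
  by_cases h2 : ‖(u : AddCircle (π * L))‖ ≤ 2
  · obtain ⟨v, hv, hvu⟩ := exists_abs_eq_norm_coe (fejer_periodic L 0) u
    rw [← hv] at hu h2
    rw [← hvu]
    clear hv hvu
    wlog h0 : 0 ≤ v generalizing v
    · simpa [fejer_neg] using this (-v) (by rwa [abs_neg]) (by rwa [abs_neg]) (by linarith)
    rw [abs_of_nonneg h0] at hu h2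
    have := fejer_zero_le_sq_of_sin_le hL (by linarith) h2 (sin_le_mul_of_mem_Icc hu h2)
    norm_num at this
    linarith
  · have hchord : 127 / 100 ≤ chord L u := by
      refine le_trans ?_ (two_div_pi_mul_norm_le_chord (by omega) u)
      rw [div_mul_eq_mul_div, le_div_iff₀ pi_pos]
      nlinarith [pi_lt_d4]
    refine (fejer_zero_le_chord (by omega) (by linarith)).trans ?_
    rw [div_le_iff₀ (by nlinarith)]
    nlinarith

/-! ### Sums over separated points -/

theorem sum_inv_sq_le_of_pos {ι : Type*} {J : Finset ι} {y : ι → ℝ} {b : ℝ} (hb : 0 < b)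
    (hy : ∀ j ∈ J, b ≤ y j) (hsep : (J : Set ι).Pairwise fun i j => b ≤ |y i - y j|) :
    ∑ j ∈ J, 1 / y j ^ 2 ≤ π ^ 2 / 6 / b ^ 2 := by
  classical
  have floor_le : ∀ j ∈ J, (⌊y j / b⌋₊ : ℝ) ≤ y j / b := fun j hj =>
    Nat.floor_le (div_nonneg (hb.le.trans (hy j hj)) hb.le)
  have floor_injOn : Set.InjOn (fun j => ⌊y j / b⌋₊) J := by
    intro i hi j hj hij
    by_contra hne
    have hdist : |y i / b - y j / b| < 1 := by
      have hi_le := floor_le i hi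
      have hi_lt := Nat.lt_floor_add_one (y i / b)
      have hij : ⌊y i / b⌋₊ = ⌊y j / b⌋₊ := hij
      rw [hij] at hi_le hi_lt
      rw [abs_lt]
      constructor <;> linarith [floor_le j hj, Nat.lt_floor_add_one (y j / b)]
    rw [← sub_div, abs_div, abs_of_pos hb, div_lt_one hb] at hdist
    exact hdist.not_ge (hsep hi hj hne)
  calc ∑ j ∈ J, 1 / y j ^ 2 ≤ ∑ j ∈ J, 1 / b ^ 2 * (1 / (⌊y j / b⌋₊ : ℝ) ^ 2) := by
        refine sum_le_sum fun j hj => ?_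
        have hpos : (0 : ℝ) < ⌊y j / b⌋₊ := by
          exact_mod_cast Nat.floor_pos.2 ((one_le_div hb).2 (hy j hj))
        rw [one_div_mul_one_div, ← mul_pow, mul_comm b]
        gcongr
        exact (le_div_iff₀ hb).1 (floor_le j hj)
    _ = 1 / b ^ 2 * ∑ n ∈ J.image (fun j => ⌊y j / b⌋₊), 1 / (n : ℝ) ^ 2 := by
        rw [sum_image floor_injOn, mul_sum]
    _ ≤ 1 / b ^ 2 * (π ^ 2 / 6) := by
        gcongr
        exact sum_le_hasSum _ (fun n _ => by positivity) hasSum_zeta_two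
    _ = π ^ 2 / 6 / b ^ 2 := by ring

theorem sum_inv_sq_le {ι : Type*} {J : Finset ι} {y : ι → ℝ} {b : ℝ} (hb : 0 < b)
    (hy : ∀ j ∈ J, b ≤ |y j|) (hsep : (J : Set ι).Pairwise fun i j => b ≤ |y i - y j|) :
    ∑ j ∈ J, 1 / y j ^ 2 ≤ π ^ 2 / 3 / b ^ 2 := by
  have sum_nonneg_part : ∑ j ∈ J with 0 ≤ y j, 1 / y j ^ 2 ≤ π ^ 2 / 6 / b ^ 2 :=
    sum_inv_sq_le_of_pos hb
      (fun j hj => abs_of_nonneg (mem_filter.1 hj).2 ▸ hy j (mem_filter.1 hj).1)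
      (hsep.mono (coe_subset.2 (filter_subset _ _)))
  have sum_neg_part : ∑ j ∈ J with ¬0 ≤ y j, 1 / y j ^ 2 ≤ π ^ 2 / 6 / b ^ 2 := by
    simp only [← neg_sq (y _)]
    refine sum_inv_sq_le_of_pos hb
      (fun j hj => abs_of_neg (not_le.1 (mem_filter.1 hj).2) ▸ hy j (mem_filter.1 hj).1)
      fun i hi j hj hij => ?_
    simp only [neg_sub_neg, abs_sub_comm]
    exact hsep (mem_filter.1 hi).1 (mem_filter.1 hj).1 hij
  calc ∑ j ∈ J, 1 / y j ^ 2
      = ∑ j ∈ J with 0 ≤ y j, 1 / y j ^ 2 + ∑ j ∈ J with ¬0 ≤ y j, 1 / y j ^ 2 :=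
        (sum_filter_add_sum_filter_not ..).symm
    _ ≤ π ^ 2 / 6 / b ^ 2 + π ^ 2 / 6 / b ^ 2 := add_le_add sum_nonneg_part sum_neg_part
    _ = π ^ 2 / 3 / b ^ 2 := by ring

theorem sum_inv_norm_sq_le {ι : Type*} {J : Finset ι} {T b : ℝ} {x : ι → AddCircle T}
    (hb : 0 < b) (hx : ∀ j ∈ J, b ≤ ‖x j‖)
    (hsep : (J : Set ι).Pairwise fun i j => b ≤ ‖x i - x j‖) :
    ∑ j ∈ J, 1 / ‖x j‖ ^ 2 ≤ π ^ 2 / 3 / b ^ 2 := by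
  have exists_lift (j : ι) : ∃ v : ℝ, |v| = ‖x j‖ ∧ (v : AddCircle T) = x j := by
    obtain ⟨w, hw⟩ := QuotientAddGroup.mk_surjective (x j)
    rw [← hw]
    exact exists_abs_eq_norm_coe (AddCircle.coe_add_period T) w
  choose y hy_abs hy_coe using exists_lift
  simp only [← hy_abs, sq_abs]
  refine sum_inv_sq_le hb (fun j hj => hy_abs j ▸ hx j hj) fun i hi j hj hij => ?_
  calc b ≤ ‖x i - x j‖ := hsep hi hj hij
    _ = ‖((y i - y j : ℝ) : AddCircle T)‖ := by rw [AddCircle.coe_sub, hy_coe, hy_coe]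
    _ ≤ |y i - y j| := QuotientAddGroup.norm_mk_le_norm

/-- The points `u j` have mutual distances at least `2.38 π` modulo `π L`. For `u j = π L ω j` this
says that the frequencies `ω j` have wrapped mutual distances at least `2.38 / L`. -/
def Separated {ι : Type*} (L : ℕ) (u : ι → ℝ) : Prop :=
  Pairwise fun i j => 238 / 100 * π ≤ ‖((u i - u j : ℝ) : AddCircle (π * L))‖

namespace Separated

variable {ι : Type*} {L : ℕ} {u : ι → ℝ}

theorem sum_inv_chord_sq_le (hu : Separated L u) (hL : 0 < L) {v κ : ℝ} (hκ : 0 < κ)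
    (hκ' : κ ≤ 476 / 100) {J : Finset ι}
    (hJ : ∀ j ∈ J, π / 2 * κ ≤ ‖((v - u j : ℝ) : AddCircle (π * L))‖) :
    ∑ j ∈ J, 1 / chord L (v - u j) ^ 2 ≤ 329 / 100 / κ ^ 2 := by
  have hsep : (J : Set ι).Pairwise fun i j =>
      π / 2 * κ ≤ ‖((v - u i : ℝ) : AddCircle (π * L)) - ((v - u j : ℝ) : AddCircle (π * L))‖ := by
    intro i _ j _ hij
    rw [← AddCircle.coe_sub, sub_sub_sub_cancel_left]
    refine le_trans ?_ (hu hij.symm)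
    nlinarith [pi_pos]
  calc ∑ j ∈ J, 1 / chord L (v - u j) ^ 2
      ≤ ∑ j ∈ J, π ^ 2 / 4 * (1 / ‖((v - u j : ℝ) : AddCircle (π * L))‖ ^ 2) := by
        refine sum_le_sum fun j hj => ?_
        have hpos : 0 < ‖((v - u j : ℝ) : AddCircle (π * L))‖ :=
          lt_of_lt_of_le (by positivity) (hJ j hj)
        calc 1 / chord L (v - u j) ^ 2
            ≤ 1 / (2 / π * ‖((v - u j : ℝ) : AddCircle (π * L))‖) ^ 2 := by
              gcongr
              exact two_div_pi_mul_norm_le_chord hL _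
          _ = π ^ 2 / 4 * (1 / ‖((v - u j : ℝ) : AddCircle (π * L))‖ ^ 2) := by
              field_simp
              norm_num
    _ ≤ π ^ 2 / 4 * (π ^ 2 / 3 / (π / 2 * κ) ^ 2) := by
        rw [← mul_sum]
        gcongr
        exact sum_inv_norm_sq_le (by positivity) hJ hsep
    _ = π ^ 2 / 3 / κ ^ 2 := by
        field_simp
        norm_num
    _ ≤ 329 / 100 / κ ^ 2 := by
        refine div_le_div_of_nonneg_right ?_ (by positivity)
        nlinarith [pi_lt_d4, pi_pos]

theorem sum_abs_le (hu : Separated L u) (hL : 0 < L) {v κ C : ℝ} (hκ : 0 < κ)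
    (hκ' : κ ≤ 476 / 100) (hC : 0 ≤ C) {g : ℝ → ℝ}
    (hg : ∀ x, κ ≤ chord L x → |g x| ≤ C * (1 / chord L x ^ 2)) {J : Finset ι}
    (hJ : ∀ j ∈ J, π / 2 * κ ≤ ‖((v - u j : ℝ) : AddCircle (π * L))‖) :
    ∑ j ∈ J, |g (v - u j)| ≤ C * (329 / 100) / κ ^ 2 :=
  calc ∑ j ∈ J, |g (v - u j)| ≤ C * ∑ j ∈ J, 1 / chord L (v - u j) ^ 2 := by
        rw [mul_sum]
        exact sum_le_sum fun j hj => hg _ (le_chord_of_le_norm hL (hJ j hj))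
    _ ≤ C * (329 / 100 / κ ^ 2) := by
        gcongr
        exact hu.sum_inv_chord_sq_le hL hκ hκ' hJ
    _ = C * (329 / 100) / κ ^ 2 := by ring

theorem sum_sq_le (hu : Separated L u) (hL : 0 < L) {v κ C : ℝ} (hκ : 0 < κ)
    (hκ' : κ ≤ 476 / 100) {g : ℝ → ℝ}
    (hg : ∀ x, κ ≤ chord L x → |g x| ≤ C * (1 / chord L x ^ 2)) {J : Finset ι}
    (hJ : ∀ j ∈ J, π / 2 * κ ≤ ‖((v - u j : ℝ) : AddCircle (π * L))‖) :
    ∑ j ∈ J, g (v - u j) ^ 2 ≤ C ^ 2 * (329 / 100) / κ ^ 4 :=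
  calc ∑ j ∈ J, g (v - u j) ^ 2
      ≤ ∑ j ∈ J, C ^ 2 * (1 / κ ^ 2) * (1 / chord L (v - u j) ^ 2) := by
        refine sum_le_sum fun j hj => ?_
        have hκ_le := le_chord_of_le_norm hL (hJ j hj)
        have hpos : 0 < chord L (v - u j) := hκ.trans_le hκ_le
        calc g (v - u j) ^ 2 = |g (v - u j)| ^ 2 := (sq_abs _).symm
          _ ≤ (C * (1 / chord L (v - u j) ^ 2)) ^ 2 := by
              gcongr
              exact hg _ hκ_le
          _ = C ^ 2 * (1 / chord L (v - u j) ^ 2) * (1 / chord L (v - u j) ^ 2) := by ring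
          _ ≤ C ^ 2 * (1 / κ ^ 2) * (1 / chord L (v - u j) ^ 2) := by gcongr
    _ ≤ C ^ 2 * (1 / κ ^ 2) * (329 / 100 / κ ^ 2) := by
        rw [← mul_sum]
        gcongr
        exact hu.sum_inv_chord_sq_le hL hκ hκ' hJ
    _ = C ^ 2 * (329 / 100) / κ ^ 4 := by field_simp

section Nodes

variable [Fintype ι] [DecidableEq ι]

theorem le_norm_node_sub (hu : Separated L u) {k j : ι} (hj : j ∈ univ.erase k) :
    π / 2 * (476 / 100) ≤ ‖((u k - u j : ℝ) : AddCircle (π * L))‖ := by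
  linarith [hu (ne_of_mem_erase hj).symm]

theorem sum_abs_fejer_zero_le (hu : Separated L u) (hL : 0 < L) (k : ι) :
    ∑ j ∈ univ.erase k, |fejer L 0 (u k - u j)| ≤ 14525 / 100000 :=
  (hu.sum_abs_le hL (κ := 476 / 100) (C := 1) (by norm_num) le_rfl zero_le_one
    (fun x hx => by
      rw [abs_of_nonneg (fejer_zero_nonneg L x), one_mul]
      exact fejer_zero_le_chord hL (by linarith)) fun _ => hu.le_norm_node_sub).trans (by norm_num)

theorem sum_abs_fejer_one_le (hu : Separated L u) (hL : 0 < L) (k : ι) :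
    ∑ j ∈ univ.erase k, |fejer L 1 (u k - u j)| ≤ 2063 / 10000 :=
  (hu.sum_abs_le hL (by norm_num) le_rfl (by norm_num)
    (fun _ => abs_fejer_one_le_chord hL (κ := 476 / 100) (by norm_num))
    fun _ => hu.le_norm_node_sub).trans (by norm_num)

theorem sum_fejer_one_sq_le (hu : Separated L u) (hL : 0 < L) (k : ι) :
    ∑ j ∈ univ.erase k, fejer L 1 (u k - u j) ^ 2 ≤ (1138 / 10000) ^ 2 :=
  (hu.sum_sq_le hL (by norm_num) le_rfl
    (fun _ => abs_fejer_one_le_chord hL (κ := 476 / 100) (by norm_num))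
    fun _ => hu.le_norm_node_sub).trans (by norm_num)

theorem le_norm_node_add_sub (hu : Separated L u) {k j : ι} (hj : j ∈ univ.erase k) {t : ℝ}
    (ht : |t| ≤ 1) : π / 2 * (412 / 100) ≤ ‖((u k + t - u j : ℝ) : AddCircle (π * L))‖ := by
  have hkj := hu (ne_of_mem_erase hj).symm
  have htri : ‖((u k - u j : ℝ) : AddCircle (π * L))‖ ≤
      ‖((u k + t - u j : ℝ) : AddCircle (π * L))‖ + |t| := by
    calc ‖((u k - u j : ℝ) : AddCircle (π * L))‖
        = ‖((u k + t - u j : ℝ) : AddCircle (π * L)) - (t : AddCircle (π * L))‖ := by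
          rw [← AddCircle.coe_sub]
          ring_nf
      _ ≤ _ := (norm_sub_le _ _).trans (add_le_add_right QuotientAddGroup.norm_mk_le_norm _)
  linarith [pi_gt_d4]

theorem sum_fejer_one_sq_near_le (hu : Separated L u) (hL : 0 < L) (k : ι) {t : ℝ}
    (ht : |t| ≤ 1) : ∑ j ∈ univ.erase k, fejer L 1 (u k + t - u j) ^ 2 ≤ (1591 / 10000) ^ 2 :=
  (hu.sum_sq_le hL (by norm_num) (by norm_num)
    (fun _ => abs_fejer_one_le_chord hL (κ := 412 / 100) (by norm_num))
    fun _ hj => hu.le_norm_node_add_sub hj ht).trans (by norm_num)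

theorem sum_fejer_two_sq_near_le (hu : Separated L u) (hL : 0 < L) (k : ι) {t : ℝ}
    (ht : |t| ≤ 1) : ∑ j ∈ univ.erase k, fejer L 2 (u k + t - u j) ^ 2 ≤ (3805 / 10000) ^ 2 :=
  (hu.sum_sq_le hL (by norm_num) (by norm_num)
    (fun _ => abs_fejer_two_le_chord hL (κ := 412 / 100) (by norm_num))
    fun _ hj => hu.le_norm_node_add_sub hj ht).trans (by norm_num)

end Nodes

section Far

variable [Fintype ι] {v : ℝ}

-- At most one node lies within `1.19 π` of `v`; all the others are covered by `sum_sq_le`.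
theorem sum_sq_far_le (hu : Separated L u) (hL : 0 < L) {B C : ℝ} {g : ℝ → ℝ}
    (hg : ∀ x, 238 / 100 ≤ chord L x → |g x| ≤ C * (1 / chord L x ^ 2))
    (hB : ∀ j, |g (v - u j)| ≤ B) :
    ∑ j, g (v - u j) ^ 2 ≤ C ^ 2 * (329 / 100) / (238 / 100) ^ 4 + B ^ 2 := by
  classical
  have card_le : #{j | ¬π / 2 * (238 / 100) ≤ ‖((v - u j : ℝ) : AddCircle (π * L))‖} ≤ 1 := by
    rw [card_le_one]
    intro i hi j hj
    by_contra hij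
    have hdist : ‖((u i - u j : ℝ) : AddCircle (π * L))‖ ≤
        ‖((v - u j : ℝ) : AddCircle (π * L))‖ + ‖((v - u i : ℝ) : AddCircle (π * L))‖ := by
      rw [← sub_sub_sub_cancel_left _ _ v, AddCircle.coe_sub]
      exact norm_sub_le _ _
    linarith [hu hij, (mem_filter.1 hi).2, (mem_filter.1 hj).2]
  rw [← sum_filter_add_sum_filter_not univ fun j =>
    π / 2 * (238 / 100) ≤ ‖((v - u j : ℝ) : AddCircle (π * L))‖]
  refine add_le_add
    (hu.sum_sq_le hL (by norm_num) (by norm_num) hg fun j hj => (mem_filter.1 hj).2) ?_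
  calc _ ≤ #{j | ¬π / 2 * (238 / 100) ≤ ‖((v - u j : ℝ) : AddCircle (π * L))‖} • B ^ 2 := by
        refine sum_le_card_nsmul _ _ _ fun j _ => ?_
        rw [← sq_abs]
        gcongr
        exact hB j
    _ ≤ 1 • B ^ 2 := by gcongr
    _ = B ^ 2 := one_nsmul _

theorem sum_fejer_zero_sq_far_le (hu : Separated L u) (hL : 7 ≤ L)
    (hv : ∀ j, 1 ≤ ‖((v - u j : ℝ) : AddCircle (π * L))‖) :
    ∑ j, fejer L 0 (v - u j) ^ 2 ≤ (7862 / 10000) ^ 2 :=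
  (hu.sum_sq_far_le (B := 718 / 1000) (C := 1) (by lia)
    (fun x hx => by
      rw [abs_of_nonneg (fejer_zero_nonneg L x), one_mul]
      exact fejer_zero_le_chord (by lia) (by linarith))
    fun j => by
      rw [abs_of_nonneg (fejer_zero_nonneg L _)]
      exact fejer_zero_le_of_one_le_norm hL (hv j)).trans (by norm_num)

theorem sum_fejer_one_sq_far_le (hu : Separated L u) (hL : 0 < L) :
    ∑ j, fejer L 1 (v - u j) ^ 2 ≤ (1021 / 1000) ^ 2 :=
  (hu.sum_sq_far_le hL (fun _ => abs_fejer_one_le_chord hL (by norm_num))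
    fun _ => abs_fejer_one_le hL _).trans (by norm_num)

end Far

end Separated

/-! ### The interpolating curve -/

theorem toEuclideanCLM_apply {ι 𝕜 : Type*} [Fintype ι] [DecidableEq ι] [RCLike 𝕜]
    (A : Matrix ι ι 𝕜) (x : EuclideanSpace 𝕜 ι) (i : ι) :
    Matrix.toEuclideanCLM (n := ι) (𝕜 := 𝕜) A x i = ∑ j, A i j * x j := by
  rw [Matrix.ofLp_toEuclideanCLM]
  rfl

-- The Schur test.
theorem norm_toEuclideanCLM_le {ι 𝕜 : Type*} [Fintype ι] [DecidableEq ι] [RCLike 𝕜]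
    (A : Matrix ι ι 𝕜) {ε : ℝ} (hε : 0 ≤ ε) (hrow : ∀ i, ∑ j, ‖A i j‖ ≤ ε)
    (hcol : ∀ j, ∑ i, ‖A i j‖ ≤ ε) : ‖Matrix.toEuclideanCLM (n := ι) (𝕜 := 𝕜) A‖ ≤ ε := by
  refine ContinuousLinearMap.opNorm_le_bound _ hε fun x => ?_
  refine le_of_sq_le_sq ?_ (by positivity)
  rw [mul_pow, EuclideanSpace.norm_sq_eq, EuclideanSpace.norm_sq_eq]
  have coord_le (i : ι) : ‖Matrix.toEuclideanCLM (n := ι) (𝕜 := 𝕜) A x i‖ ^ 2 ≤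
      ε * ∑ j, ‖A i j‖ * ‖x j‖ ^ 2 :=
    calc ‖Matrix.toEuclideanCLM (n := ι) (𝕜 := 𝕜) A x i‖ ^ 2
        ≤ (∑ j, ‖A i j‖ * ‖x j‖) ^ 2 := by
          rw [toEuclideanCLM_apply]
          gcongr
          exact norm_sum_le_of_le _ fun j _ => norm_mul_le _ _
      _ ≤ (∑ j, ‖A i j‖) * ∑ j, ‖A i j‖ * ‖x j‖ ^ 2 :=
          sum_sq_le_sum_mul_sum_of_sq_le_mul _ (fun j _ => norm_nonneg _)
            (fun j _ => by positivity) fun j _ => le_of_eq (by ring)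
      _ ≤ ε * ∑ j, ‖A i j‖ * ‖x j‖ ^ 2 := by
          gcongr
          exact hrow i
  calc ∑ i, ‖Matrix.toEuclideanCLM (n := ι) (𝕜 := 𝕜) A x i‖ ^ 2
      ≤ ∑ i, ε * ∑ j, ‖A i j‖ * ‖x j‖ ^ 2 := sum_le_sum fun i _ => coord_le i
    _ = ε * ∑ j, (∑ i, ‖A i j‖) * ‖x j‖ ^ 2 := by
        rw [← mul_sum, sum_comm]
        simp only [sum_mul]
    _ ≤ ε * ∑ j, ε * ‖x j‖ ^ 2 := by
        gcongr with j
        exact hcol j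
    _ = ε ^ 2 * ∑ j, ‖x j‖ ^ 2 := by
        rw [← mul_sum]
        ring

theorem abs_apply_le_norm {ι : Type*} [Fintype ι] (x : EuclideanSpace ℝ ι) (k : ι) :
    |x k| ≤ ‖x‖ :=
  PiLp.norm_apply_le x k

section ShiftVec

variable {ι : Type*} (u : ι → ℝ) (g : ℝ → ℝ) (v : ℝ)

/-- The vector of the values of `g` at the translates `v - u j`. -/
noncomputable def shiftVec : EuclideanSpace ℝ ι := WithLp.toLp 2 fun j => g (v - u j)

theorem shiftVec_apply (j : ι) : shiftVec u g v j = g (v - u j) := rfl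

theorem hasDerivAt_shiftVec [Fintype ι] {g g' : ℝ → ℝ} (hg : ∀ x, HasDerivAt g (g' x) x) :
    HasDerivAt (shiftVec u g) (shiftVec u g' v) v :=
  (PiLp.continuousLinearEquiv 2 ℝ fun _ : ι => ℝ).symm.hasFDerivAt.comp_hasDerivAt v
    (hasDerivAt_pi.2 fun j => (hg (v - u j)).comp_sub_const v (u j))

theorem shiftVec_periodic {g : ℝ → ℝ} {T : ℝ} (hg : Function.Periodic g T) :
    Function.Periodic (shiftVec u g) T := fun v => by
  ext j
  rw [shiftVec_apply, shiftVec_apply, add_sub_right_comm, hg]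

variable [Fintype ι]

theorem norm_shiftVec_sq : ‖shiftVec u g v‖ ^ 2 = ∑ j, g (v - u j) ^ 2 :=
  EuclideanSpace.real_norm_sq_eq _

variable [DecidableEq ι] (k : ι)

theorem norm_shiftVec_sq_eq_add :
    ‖shiftVec u g v‖ ^ 2 = g (v - u k) ^ 2 + ∑ j ∈ univ.erase k, g (v - u j) ^ 2 := by
  rw [norm_shiftVec_sq, add_sum_erase univ (fun j => g (v - u j) ^ 2) (mem_univ k)]

theorem norm_shiftVec_sub_single_sq :
    ‖shiftVec u g v - g (v - u k) • EuclideanSpace.single k 1‖ ^ 2 =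
      ∑ j ∈ univ.erase k, g (v - u j) ^ 2 := by
  rw [EuclideanSpace.real_norm_sq_eq, ← add_sum_erase _ _ (mem_univ k)]
  simp only [PiLp.sub_apply, shiftVec_apply, PiLp.smul_apply, PiLp.single_apply, smul_eq_mul,
    if_true, mul_one, sub_self, zero_pow two_ne_zero, zero_add]
  refine sum_congr rfl fun j hj => ?_
  rw [if_neg (ne_of_mem_erase hj), mul_zero, sub_zero]

end ShiftVec

section Curve

variable {ι : Type*} [Fintype ι] [DecidableEq ι]

/-- The matrix whose `k`-th column holds the values, at the distances to the node `u k`, of the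
`n`-th derivative of the Fejér kernel, as an operator. -/
noncomputable def gram (L n : ℕ) (u : ι → ℝ) : EuclideanSpace ℝ ι →L[ℝ] EuclideanSpace ℝ ι :=
  Matrix.toEuclideanCLM (n := ι) (𝕜 := ℝ) (Matrix.of fun i j => fejer L n (u j - u i))

/-- The inverse of the Gram matrix of the Fejér kernels centred at the nodes, with value `0` if the
matrix is singular. -/
noncomputable def gramInv (L : ℕ) (u : ι → ℝ) : EuclideanSpace ℝ ι →L[ℝ] EuclideanSpace ℝ ι :=
  Ring.inverse (gram L 0 u)

/-- The `n`-th derivative of the vector of cardinal functions of the nodes: the combinations of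
translated Fejér kernels that take the values of the `k`-th basis vector at `u k`. -/
noncomputable def cardinal (L : ℕ) (u : ι → ℝ) (n : ℕ) (v : ℝ) : EuclideanSpace ℝ ι :=
  gramInv L u (shiftVec u (fejer L n) v)

/-- The `n`-th derivative of a vector of kernel combinations that vanish at all nodes but have a
nonzero slope at one of them. -/
noncomputable def correction (L : ℕ) (u : ι → ℝ) (n : ℕ) (v : ℝ) : EuclideanSpace ℝ ι :=
  shiftVec u (fejer L (n + 1)) v - gram L 1 u (cardinal L u n v)

/-- The multiple of the `k`-th correction that cancels the slope of the `k`-th cardinal function at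
its own node. -/
noncomputable def slopeRatio (L : ℕ) (u : ι → ℝ) (k : ι) : ℝ :=
  cardinal L u 1 (u k) k / correction L u 1 (u k) k

/-- The diagonal operator of the slope ratios. -/
noncomputable def slopeOp (L : ℕ) (u : ι → ℝ) : EuclideanSpace ℝ ι →L[ℝ] EuclideanSpace ℝ ι :=
  Matrix.toEuclideanCLM (n := ι) (𝕜 := ℝ) (Matrix.diagonal (slopeRatio L u))

/-- The `n`-th derivative of the interpolating curve: it passes through the `k`-th basis vector at
`u k`, with velocity orthogonal to that vector. -/
noncomputable def interpolant (L : ℕ) (u : ι → ℝ) (n : ℕ) (v : ℝ) : EuclideanSpace ℝ ι :=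
  cardinal L u n v - slopeOp L u (correction L u n v)

variable {L : ℕ} {u : ι → ℝ}

theorem gram_single (n : ℕ) (k : ι) :
    gram L n u (EuclideanSpace.single k 1) = shiftVec u (fejer L n) (u k) := by
  ext j
  simp [gram, toEuclideanCLM_apply, shiftVec_apply]

theorem gram_apply (n : ℕ) (x : EuclideanSpace ℝ ι) (k : ι) :
    gram L n u x k = ∑ j, fejer L n (u j - u k) * x j :=
  toEuclideanCLM_apply _ _ _

theorem slopeOp_apply (x : EuclideanSpace ℝ ι) (k : ι) :
    slopeOp L u x k = slopeRatio L u k * x k := by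
  simp [slopeOp, toEuclideanCLM_apply, Matrix.diagonal_apply]

theorem interpolant_apply (n : ℕ) (v : ℝ) (k : ι) :
    interpolant L u n v k = cardinal L u n v k - slopeRatio L u k * correction L u n v k := by
  rw [interpolant, PiLp.sub_apply, slopeOp_apply]

theorem abs_fejer_sub_comm (n : ℕ) (x y : ℝ) : |fejer L n (x - y)| = |fejer L n (y - x)| := by
  rw [← neg_sub, fejer_neg, abs_mul, abs_pow, abs_neg, abs_one, one_pow, one_mul]

theorem hasDerivAt_cardinal (n : ℕ) (v : ℝ) :
    HasDerivAt (cardinal L u n) (cardinal L u (n + 1) v) v :=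
  (gramInv L u).hasFDerivAt.comp_hasDerivAt v (hasDerivAt_shiftVec u v (hasDerivAt_fejer L n))

theorem hasDerivAt_interpolant (n : ℕ) (v : ℝ) :
    HasDerivAt (interpolant L u n) (interpolant L u (n + 1) v) v :=
  (hasDerivAt_cardinal n v).sub <| (slopeOp L u).hasFDerivAt.comp_hasDerivAt v <|
    (hasDerivAt_shiftVec u v (hasDerivAt_fejer L (n + 1))).sub <|
      (gram L 1 u).hasFDerivAt.comp_hasDerivAt v (hasDerivAt_cardinal n v)

theorem interpolant_periodic (n : ℕ) : Function.Periodic (interpolant L u n) (π * L) := fun v => by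
  simp only [interpolant, correction, cardinal, shiftVec_periodic u (fejer_periodic L _) v]

namespace Separated

section Gram

variable (hu : Separated L u) (hL : 0 < L)
include hu hL

theorem norm_one_sub_gram_le : ‖1 - gram L 0 u‖ ≤ 14525 / 100000 := by
  have row_sum_le (i : ι) :
      ∑ j, ‖(1 - Matrix.of fun i j => fejer L 0 (u j - u i) : Matrix ι ι ℝ) i j‖ ≤
        14525 / 100000 := by
    rw [← add_sum_erase _ _ (mem_univ i)]
    refine le_trans (le_of_eq ?_) (hu.sum_abs_fejer_zero_le hL i)
    simp only [Matrix.sub_apply, Matrix.one_apply_eq, Matrix.of_apply, sub_self,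
      fejer_zero_zero hL, norm_zero, zero_add]
    refine sum_congr rfl fun j hj => ?_
    rw [Matrix.one_apply_ne (ne_of_mem_erase hj).symm, zero_sub, norm_neg, Real.norm_eq_abs,
      abs_fejer_sub_comm]
  have hsymm (i j : ι) : ‖(1 - Matrix.of fun i j => fejer L 0 (u j - u i) : Matrix ι ι ℝ) i j‖ =
      ‖(1 - Matrix.of fun i j => fejer L 0 (u j - u i) : Matrix ι ι ℝ) j i‖ := by
    have heven : fejer L 0 (u i - u j) = fejer L 0 (u j - u i) := by
      rw [← neg_sub, fejer_neg, pow_zero, one_mul]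
    simp [Matrix.one_apply, eq_comm, heven]
  rw [gram, ← map_one (Matrix.toEuclideanCLM (n := ι) (𝕜 := ℝ)), ← map_sub]
  exact norm_toEuclideanCLM_le _ (by norm_num) row_sum_le fun j => by
    simpa only [hsymm _ j] using row_sum_le j

theorem norm_gram_one_le : ‖gram L 1 u‖ ≤ 2063 / 10000 := by
  have col_sum_le (j : ι) : ∑ i, |fejer L 1 (u j - u i)| ≤ 2063 / 10000 := by
    rw [← add_sum_erase _ _ (mem_univ j), sub_self, fejer_one_zero, abs_zero, zero_add]
    exact hu.sum_abs_fejer_one_le hL j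
  refine norm_toEuclideanCLM_le _ (by norm_num) (fun i => ?_) col_sum_le
  simpa only [Matrix.of_apply, Real.norm_eq_abs, abs_fejer_sub_comm (y := u i)]
    using col_sum_le i

omit [DecidableEq ι] in
theorem norm_shiftVec_fejer_one_node_le (k : ι) :
    ‖shiftVec u (fejer L 1) (u k)‖ ≤ 1138 / 10000 := by
  classical
  refine le_of_sq_le_sq ?_ (by norm_num)
  rw [norm_shiftVec_sq_eq_add _ _ _ k, sub_self, fejer_one_zero, zero_pow two_ne_zero, zero_add]
  exact hu.sum_fejer_one_sq_le hL k

theorem abs_gram_one_apply_le (x : EuclideanSpace ℝ ι) (k : ι) :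
    |gram L 1 u x k| ≤ 1138 / 10000 * ‖x‖ := by
  have hinner : gram L 1 u x k = -inner ℝ (shiftVec u (fejer L 1) (u k)) x := by
    simp only [gram_apply, PiLp.inner_apply, shiftVec_apply, ← sum_neg_distrib]
    refine sum_congr rfl fun j _ => ?_
    rw [← neg_sub (u k), fejer_neg]
    simp [mul_comm]
  rw [hinner, abs_neg]
  refine (abs_real_inner_le_norm _ _).trans ?_
  gcongr
  exact hu.norm_shiftVec_fejer_one_node_le hL k

theorem gramInv_mul_gram : gramInv L u * gram L 0 u = 1 := by
  have hlt : ‖1 - gram L 0 u‖ < 1 := (hu.norm_one_sub_gram_le hL).trans_lt (by norm_num)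
  refine Ring.inverse_mul_cancel _ ?_
  simpa using isUnit_one_sub_of_norm_lt_one hlt

theorem norm_gramInv_sub_one_le_mul : ‖gramInv L u - 1‖ ≤ 14525 / 100000 * ‖gramInv L u‖ := by
  rw [show gramInv L u - 1 = gramInv L u * (1 - gram L 0 u) by
    rw [mul_sub, hu.gramInv_mul_gram hL, mul_one], mul_comm]
  refine (norm_mul_le _ _).trans ?_
  gcongr
  exact hu.norm_one_sub_gram_le hL

theorem norm_gramInv_le : ‖gramInv L u‖ ≤ 117 / 100 := by
  have htri := norm_le_norm_sub_add (gramInv L u) 1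
  have hone : ‖(1 : EuclideanSpace ℝ ι →L[ℝ] EuclideanSpace ℝ ι)‖ ≤ 1 :=
    ContinuousLinearMap.norm_id_le
  linarith [hu.norm_gramInv_sub_one_le_mul hL]

theorem norm_gramInv_sub_one_le : ‖gramInv L u - 1‖ ≤ 17 / 100 := by
  linarith [hu.norm_gramInv_sub_one_le_mul hL, hu.norm_gramInv_le hL]

theorem cardinal_zero_node (k : ι) : cardinal L u 0 (u k) = EuclideanSpace.single k 1 := by
  rw [cardinal, ← gram_single, ← mul_apply_eq_comp, hu.gramInv_mul_gram hL,
    one_apply_eq_self]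

theorem correction_zero_node (k : ι) : correction L u 0 (u k) = 0 := by
  rw [correction, hu.cardinal_zero_node hL, gram_single, sub_self]

theorem interpolant_zero_node (k : ι) : interpolant L u 0 (u k) = EuclideanSpace.single k 1 := by
  rw [interpolant, hu.correction_zero_node hL, map_zero, sub_zero, hu.cardinal_zero_node hL]

theorem norm_cardinal_le {n : ℕ} {v a : ℝ} (ha : ‖shiftVec u (fejer L n) v‖ ≤ a) :
    ‖cardinal L u n v‖ ≤ 117 / 100 * a :=
  (gramInv L u).le_of_opNorm_le_of_le (hu.norm_gramInv_le hL) ha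

theorem norm_cardinal_sub_le {n : ℕ} {v a : ℝ} (ha : ‖shiftVec u (fejer L n) v‖ ≤ a) :
    ‖cardinal L u n v - shiftVec u (fejer L n) v‖ ≤ 17 / 100 * a :=
  (gramInv L u - 1).le_of_opNorm_le_of_le (hu.norm_gramInv_sub_one_le hL) ha

theorem norm_correction_le {n : ℕ} {v a b : ℝ} (ha : ‖shiftVec u (fejer L n) v‖ ≤ a)
    (hb : ‖shiftVec u (fejer L (n + 1)) v‖ ≤ b) :
    ‖correction L u n v‖ ≤ b + 2063 / 10000 * (117 / 100 * a) :=
  norm_sub_le_of_le hb <|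
    (gram L 1 u).le_of_opNorm_le_of_le (hu.norm_gram_one_le hL) (hu.norm_cardinal_le hL ha)

theorem abs_gram_cardinal_apply_le {n : ℕ} {v a : ℝ} (ha : ‖shiftVec u (fejer L n) v‖ ≤ a)
    (k : ι) : |gram L 1 u (cardinal L u n v) k| ≤ 1138 / 10000 * (117 / 100 * a) := by
  refine (hu.abs_gram_one_apply_le hL _ k).trans ?_
  gcongr
  exact hu.norm_cardinal_le hL ha

end Gram

section Curve

variable (hu : Separated L u) (hL : 7 ≤ L)
include hu hL

theorem abs_cardinal_one_node_apply_le (k : ι) :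
    |cardinal L u 1 (u k) k| ≤ 17 / 100 * (1138 / 10000) := by
  have hzero : shiftVec u (fejer L 1) (u k) k = 0 := by
    rw [shiftVec_apply, sub_self, fejer_one_zero]
  rw [← sub_zero (cardinal L u 1 (u k) k), ← hzero, ← PiLp.sub_apply]
  exact (abs_apply_le_norm _ k).trans
    (hu.norm_cardinal_sub_le (by lia) (hu.norm_shiftVec_fejer_one_node_le (by lia) k))

theorem correction_one_node_apply_le (k : ι) : correction L u 1 (u k) k ≤ -(6378 / 10000) := by
  have hgram := neg_le_of_abs_le <| hu.abs_gram_cardinal_apply_le (by lia)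
    (hu.norm_shiftVec_fejer_one_node_le (by lia) k) k
  rw [correction, PiLp.sub_apply, shiftVec_apply, sub_self]
  linarith [fejer_two_zero_le hL]

theorem abs_slopeRatio_le (k : ι) : |slopeRatio L u k| ≤ 304 / 10000 := by
  have hden := hu.correction_one_node_apply_le hL k
  rw [slopeRatio, abs_div, abs_of_neg (show correction L u 1 (u k) k < 0 by linarith),
    div_le_iff₀ (by linarith)]
  linarith [hu.abs_cardinal_one_node_apply_le hL k]

theorem norm_slopeOp_le : ‖slopeOp L u‖ ≤ 304 / 10000 := by
  refine norm_toEuclideanCLM_le _ (by norm_num) (fun i => ?_) fun j => ?_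
  · simpa [Matrix.diagonal_apply, apply_ite norm] using hu.abs_slopeRatio_le hL i
  · simpa [Matrix.diagonal_apply, apply_ite norm] using hu.abs_slopeRatio_le hL j

theorem interpolant_one_node_apply (k : ι) : interpolant L u 1 (u k) k = 0 := by
  have hden := hu.correction_one_node_apply_le hL k
  rw [interpolant_apply, slopeRatio, div_mul_cancel₀ _ (by linarith), sub_self]

theorem norm_slopeOp_correction_le {n : ℕ} {v a b : ℝ} (ha : ‖shiftVec u (fejer L n) v‖ ≤ a)
    (hb : ‖shiftVec u (fejer L (n + 1)) v‖ ≤ b) :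
    ‖slopeOp L u (correction L u n v)‖ ≤ 304 / 10000 * (b + 2063 / 10000 * (117 / 100 * a)) :=
  (slopeOp L u).le_of_opNorm_le_of_le (hu.norm_slopeOp_le hL)
    (hu.norm_correction_le (by lia) ha hb)

theorem norm_interpolant_far_le {v : ℝ}
    (hv : ∀ j, 1 ≤ ‖((v - u j : ℝ) : AddCircle (π * L))‖) :
    ‖interpolant L u 0 v‖ ≤ 96 / 100 := by
  have hF₀ : ‖shiftVec u (fejer L 0) v‖ ≤ 7862 / 10000 :=
    le_of_sq_le_sq (norm_shiftVec_sq u _ v ▸ hu.sum_fejer_zero_sq_far_le hL hv) (by norm_num)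
  have hF₁ : ‖shiftVec u (fejer L 1) v‖ ≤ 1021 / 1000 :=
    le_of_sq_le_sq (norm_shiftVec_sq u _ v ▸ hu.sum_fejer_one_sq_far_le (by lia)) (by norm_num)
  exact (norm_sub_le_of_le (hu.norm_cardinal_le (by lia) hF₀)
    (hu.norm_slopeOp_correction_le hL hF₀ hF₁)).trans (by norm_num)

end Curve

end Separated

end Curve

/-! ### The curve near a node -/

section Near

variable {ι : Type*} [Fintype ι] [DecidableEq ι] {L : ℕ} {u : ι → ℝ}

/-- The difference between the interpolating curve near `u k` and the Fejér kernel moving along the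
`k`-th axis. -/
noncomputable def remainder (L : ℕ) (u : ι → ℝ) (k : ι) (n : ℕ) (t : ℝ) : EuclideanSpace ℝ ι :=
  interpolant L u n (u k + t) - fejer L n t • EuclideanSpace.single k 1

theorem hasDerivAt_remainder (k : ι) (n : ℕ) (t : ℝ) :
    HasDerivAt (remainder L u k n) (remainder L u k (n + 1) t) t :=
  ((hasDerivAt_interpolant n (u k + t)).comp_const_add (u k) t).sub
    ((hasDerivAt_fejer L n t).smul_const _)

theorem hasDerivAt_remainder_apply (k : ι) (n : ℕ) (t : ℝ) :
    HasDerivAt (fun t => remainder L u k n t k) (remainder L u k (n + 1) t k) t :=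
  (EuclideanSpace.proj k : EuclideanSpace ℝ ι →L[ℝ] ℝ).hasFDerivAt.comp_hasDerivAt t
    (hasDerivAt_remainder k n t)

theorem remainder_apply_self (k : ι) (n : ℕ) (t : ℝ) :
    remainder L u k n t k = interpolant L u n (u k + t) k - fejer L n t := by
  simp [remainder]

namespace Separated

section Bounds

variable (hu : Separated L u) (hL : 0 < L) (k : ι) {t : ℝ} (ht : |t| ≤ 1)
include hu hL ht

omit [DecidableEq ι] in
theorem norm_shiftVec_fejer_one_near_le :
    ‖shiftVec u (fejer L 1) (u k + t)‖ ≤ 6855 / 10000 := by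
  classical
  refine le_of_sq_le_sq ?_ (by norm_num)
  rw [norm_shiftVec_sq_eq_add _ _ _ k, add_sub_cancel_left]
  have hself : fejer L 1 t ^ 2 ≤ (2 / 3) ^ 2 :=
    sq_le_sq' (by linarith [neg_le_of_abs_le (abs_fejer_one_le_mul hL t)])
      (by linarith [le_of_abs_le (abs_fejer_one_le_mul hL t)])
  exact (add_le_add hself (hu.sum_fejer_one_sq_near_le hL k ht)).trans (by norm_num)

omit [DecidableEq ι] in
theorem norm_shiftVec_fejer_two_near_le :
    ‖shiftVec u (fejer L 2) (u k + t)‖ ≤ 7677 / 10000 := by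
  classical
  refine le_of_sq_le_sq ?_ (by norm_num)
  rw [norm_shiftVec_sq_eq_add _ _ _ k, add_sub_cancel_left]
  have hself : fejer L 2 t ^ 2 ≤ (2 / 3) ^ 2 := sq_le_sq.2 <| by
    rw [abs_of_pos (by norm_num : (0 : ℝ) < 2 / 3)]
    exact abs_fejer_two_le hL t
  exact (add_le_add hself (hu.sum_fejer_two_sq_near_le hL k ht)).trans (by norm_num)

theorem norm_shiftVec_fejer_one_sub_le :
    ‖shiftVec u (fejer L 1) (u k + t) - fejer L 1 t • EuclideanSpace.single k 1‖ ≤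
      1591 / 10000 := by
  refine le_of_sq_le_sq ?_ (by norm_num)
  have hsplit := norm_shiftVec_sub_single_sq u (fejer L 1) (u k + t) k
  rw [add_sub_cancel_left] at hsplit
  rw [hsplit]
  exact hu.sum_fejer_one_sq_near_le hL k ht

end Bounds

section Node

variable (hu : Separated L u) (hL : 7 ≤ L) (k : ι)
include hu hL

theorem remainder_zero_zero : remainder L u k 0 0 = 0 := by
  rw [remainder, add_zero, hu.interpolant_zero_node (by lia), fejer_zero_zero (by lia), one_smul,
    sub_self]

theorem remainder_one_zero_apply_self : remainder L u k 1 0 k = 0 := by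
  rw [remainder_apply_self, add_zero, hu.interpolant_one_node_apply hL, fejer_one_zero, sub_zero]

variable {t : ℝ} (ht : |t| ≤ 1)
include ht

theorem norm_remainder_one_le : ‖remainder L u k 1 t‖ ≤ 3041 / 10000 := by
  have hF₁ := hu.norm_shiftVec_fejer_one_near_le (by lia) k ht
  have hsplit : remainder L u k 1 t =
      (cardinal L u 1 (u k + t) - shiftVec u (fejer L 1) (u k + t)) +
        (shiftVec u (fejer L 1) (u k + t) - fejer L 1 t • EuclideanSpace.single k 1) -
        slopeOp L u (correction L u 1 (u k + t)) := by
    rw [remainder, interpolant]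
    abel
  rw [hsplit]
  exact (norm_sub_le_of_le (norm_add_le_of_le (hu.norm_cardinal_sub_le (by lia) hF₁)
    (hu.norm_shiftVec_fejer_one_sub_le (by lia) k ht)) (hu.norm_slopeOp_correction_le hL hF₁
      (hu.norm_shiftVec_fejer_two_near_le (by lia) k ht))).trans (by norm_num)

theorem abs_remainder_two_apply_self_le : |remainder L u k 2 t k| ≤ 1742 / 10000 := by
  have hF₂ := hu.norm_shiftVec_fejer_two_near_le (by lia) k ht
  have hsplit : remainder L u k 2 t k =
      (cardinal L u 2 (u k + t) - shiftVec u (fejer L 2) (u k + t)) k -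
        slopeRatio L u k * (fejer L 3 t - gram L 1 u (cardinal L u 2 (u k + t)) k) := by
    rw [remainder_apply_self, interpolant_apply, correction, PiLp.sub_apply, PiLp.sub_apply,
      shiftVec_apply, shiftVec_apply, add_sub_cancel_left]
    ring
  have hcardinal := (abs_apply_le_norm _ k).trans (hu.norm_cardinal_sub_le (by lia) hF₂)
  have hcorrection : |fejer L 3 t - gram L 1 u (cardinal L u 2 (u k + t)) k| ≤
      4 / 3 + 1138 / 10000 * (117 / 100 * (7677 / 10000)) :=
    (abs_sub _ _).trans (add_le_add (abs_fejer_three_le (by lia) t)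
      (hu.abs_gram_cardinal_apply_le (by lia) hF₂ k))
  calc |remainder L u k 2 t k| ≤ 17 / 100 * (7677 / 10000) +
        304 / 10000 * (4 / 3 + 1138 / 10000 * (117 / 100 * (7677 / 10000))) := by
        rw [hsplit]
        refine (abs_sub _ _).trans (add_le_add hcardinal ?_)
        rw [abs_mul]
        exact mul_le_mul (hu.abs_slopeRatio_le hL k) hcorrection (abs_nonneg _) (by norm_num)
    _ ≤ 1742 / 10000 := by norm_num

theorem norm_remainder_zero_le : ‖remainder L u k 0 t‖ ≤ 3041 / 10000 * |t| :=
  norm_le_mul_abs_of_hasDerivAt (hu.remainder_zero_zero hL k)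
    (fun x => hasDerivAt_remainder k 0 x) (fun _ hx => hu.norm_remainder_one_le hL k hx) ht

theorem abs_remainder_zero_apply_self_le : |remainder L u k 0 t k| ≤ 1742 / 10000 * t ^ 2 := by
  have slope_le (x : ℝ) (hx : |x| ≤ |t|) : ‖remainder L u k 1 x k‖ ≤ 1742 / 10000 * |t| :=
    (norm_le_mul_abs_of_hasDerivAt (hu.remainder_one_zero_apply_self hL k)
      (fun x => hasDerivAt_remainder_apply k 1 x)
      (fun _ hx => hu.abs_remainder_two_apply_self_le hL k hx) (hx.trans ht)).trans (by gcongr)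
  have hvalue := norm_le_mul_abs_of_hasDerivAt (f := fun x => remainder L u k 0 x k)
    (by simp [hu.remainder_zero_zero hL k]) (fun x => hasDerivAt_remainder_apply k 0 x) slope_le
    le_rfl
  rwa [mul_assoc, ← sq, sq_abs] at hvalue

-- The squared norm is `F² + 2 F r_k + ‖r‖²`: the kernel loses `0.48 t²`, the remainder `r` gives
-- back at most `(2 · 0.1742 + 0.3041²) t² < 0.45 t²`.
theorem norm_interpolant_near_lt_one (ht₀ : t ≠ 0) : ‖interpolant L u 0 (u k + t)‖ < 1 := by
  have hF := fejer_zero_sq_le hL ht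
  have hF₀ := fejer_zero_nonneg L t
  have ht_pos : 0 < t ^ 2 := by positivity
  have hF_one : fejer L 0 t ≤ 1 := by nlinarith
  have hcross : fejer L 0 t * remainder L u k 0 t k ≤ 1742 / 10000 * t ^ 2 :=
    calc fejer L 0 t * remainder L u k 0 t k ≤ fejer L 0 t * |remainder L u k 0 t k| := by
          gcongr
          exact le_abs_self _
      _ ≤ 1 * (1742 / 10000 * t ^ 2) := by
          gcongr
          exact hu.abs_remainder_zero_apply_self_le hL k ht
      _ = 1742 / 10000 * t ^ 2 := one_mul _
  have hrem : ‖remainder L u k 0 t‖ ^ 2 ≤ (3041 / 10000) ^ 2 * t ^ 2 := by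
    rw [← sq_abs t, ← mul_pow]
    gcongr
    exact hu.norm_remainder_zero_le hL k ht
  have hnorm : ‖interpolant L u 0 (u k + t)‖ ^ 2 = fejer L 0 t ^ 2 +
      2 * (fejer L 0 t * remainder L u k 0 t k) + ‖remainder L u k 0 t‖ ^ 2 := by
    rw [← add_sub_cancel (fejer L 0 t • EuclideanSpace.single k 1) (interpolant L u 0 (u k + t)),
      ← remainder, norm_add_sq_real, norm_smul, inner_smul_left, EuclideanSpace.inner_single_left,
      PiLp.norm_single, norm_one, mul_one, Real.norm_eq_abs, sq_abs]
    simp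
  refine lt_of_pow_lt_pow_left₀ 2 zero_le_one ?_
  rw [hnorm]
  linarith

end Node

theorem norm_interpolant_lt_one (hu : Separated L u) (hL : 7 ≤ L) {v : ℝ}
    (hv : ∀ j, ((v - u j : ℝ) : AddCircle (π * L)) ≠ 0) : ‖interpolant L u 0 v‖ < 1 := by
  by_cases hfar : ∀ j, 1 ≤ ‖((v - u j : ℝ) : AddCircle (π * L))‖
  · exact (hu.norm_interpolant_far_le hL hfar).trans_lt (by norm_num)
  · push Not at hfar
    obtain ⟨k, hk⟩ := hfar
    obtain ⟨t, ht_abs, ht⟩ :=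
      exists_abs_eq_norm_coe ((interpolant_periodic (u := u) 0).const_add (u k)) (v - u k)
    rw [add_sub_cancel] at ht
    rw [← ht]
    refine hu.norm_interpolant_near_lt_one hL k (ht_abs ▸ hk.le) ?_
    rw [← abs_pos, ht_abs, norm_pos_iff]
    exact hv k

end Separated

end Near

/-! ### Trigonometric polynomials in the sine of the angle -/

/-- The functions of the angle that become polynomials of degree less than `N` in
`z = exp (2 π i sin φ)` after multiplication by `z ^ d`; these polynomials are given by their
coefficient vectors, paired with the array response. -/
def trigSpan (N d : ℕ) : Submodule ℂ (ℝ → ℂ) where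
  carrier := {g | ∃ q : Fin N → ℂ, ∀ φ, q ⬝ᵥ arrayResponse N φ =
    Complex.exp (2 * π * Complex.I * (sin φ : ℂ) * (d : ℂ)) * g φ}
  add_mem' := by
    rintro f g ⟨p, hp⟩ ⟨q, hq⟩
    exact ⟨p + q, fun φ => by rw [add_dotProduct, hp, hq, Pi.add_apply, mul_add]⟩
  zero_mem' := ⟨0, fun φ => by simp⟩
  smul_mem' := by
    rintro c f ⟨p, hp⟩
    exact ⟨c • p, fun φ => by
      rw [smul_dotProduct, hp, Pi.smul_apply, smul_eq_mul, smul_eq_mul, mul_left_comm]⟩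

theorem exp_mem_trigSpan {N d : ℕ} (hN : 2 * d < N) {n : ℤ} (hn : |n| ≤ d) :
    (fun φ => Complex.exp (2 * π * Complex.I * (sin φ : ℂ) * (n : ℂ))) ∈ trigSpan N d := by
  obtain ⟨hn₁, hn₂⟩ := abs_le.1 hn
  have hcast : (((n + d).toNat : ℕ) : ℂ) = n + d := by
    exact_mod_cast congrArg (Int.cast : ℤ → ℂ) (Int.toNat_of_nonneg (by omega : 0 ≤ n + d))
  refine ⟨Pi.single ⟨(n + d).toNat, by omega⟩ 1, fun φ => ?_⟩
  rw [single_one_dotProduct, arrayResponse, ← Complex.exp_add, hcast, mul_add, add_comm]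

theorem cos_mem_trigSpan {N d : ℕ} (hN : 2 * d < N) {n : ℤ} (hn : |n| ≤ d) (c : ℝ) :
    (fun φ => (cos (2 * π * n * sin φ + c) : ℂ)) ∈ trigSpan N d := by
  have hneg := exp_mem_trigSpan hN (n := -n) (by rwa [abs_neg])
  convert add_mem ((trigSpan N d).smul_mem (Complex.exp (c * Complex.I) / 2)
    (exp_mem_trigSpan hN hn)) ((trigSpan N d).smul_mem (Complex.exp (-c * Complex.I) / 2) hneg)
    using 1
  ext φ
  simp only [Pi.add_apply, Pi.smul_apply, smul_eq_mul, div_mul_eq_mul_div, ← Complex.exp_add,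
    Complex.ofReal_cos, Complex.cos]
  push_cast
  ring_nf

theorem freqAvg_mem_trigSpan {N L : ℕ} (hL : 0 < L) (f : ℝ → ℝ → ℝ)
    (h : ∀ n : ℤ, |n| ≤ (L - 1 : ℕ) → (fun φ => (f φ (2 * n / L) : ℂ)) ∈ trigSpan N (L - 1)) :
    (fun φ => (freqAvg L (f φ) : ℂ)) ∈ trigSpan N (L - 1) := by
  have hsum : (fun φ => (freqAvg L (f φ) : ℂ)) = (1 / (L : ℂ) ^ 2) •
      ∑ j ∈ range L, ∑ k ∈ range L, fun φ => (f φ (2 * ((j : ℤ) - k : ℤ) / L) : ℂ) := by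
    ext φ
    simp only [freqAvg, Pi.smul_apply, Finset.sum_apply, smul_eq_mul]
    push_cast
    ring
  rw [hsum]
  refine Submodule.smul_mem _ _ (sum_mem fun j hj => sum_mem fun k hk => h _ ?_)
  rw [mem_range] at hj hk
  exact abs_le.2 ⟨by omega, by omega⟩

theorem fejer_mem_trigSpan {N L : ℕ} (hL : 0 < L) (hN : 2 * (L - 1) < N) (n : ℕ) (c : ℝ) :
    (fun φ => (fejer L n (L * π * sin φ - c) : ℂ)) ∈ trigSpan N (L - 1) := by
  have hL₀ : (L : ℝ) ≠ 0 := by positivity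
  refine freqAvg_mem_trigSpan hL _ fun m hm => ?_
  convert (trigSpan N (L - 1)).smul_mem (((2 * m / L : ℝ) : ℂ) ^ n)
    (cos_mem_trigSpan hN hm (n * (π / 2) - 2 * m / L * c)) using 1
  ext φ
  rw [Pi.smul_apply, smul_eq_mul, ← Complex.ofReal_pow, ← Complex.ofReal_mul]
  congr 3
  field_simp
  ring

theorem clm_apply_mem_submodule {ι α : Type*} [Finite ι] (S : Submodule ℂ (α → ℂ))
    (A : EuclideanSpace ℝ ι →L[ℝ] EuclideanSpace ℝ ι) {x : α → EuclideanSpace ℝ ι}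
    (hx : ∀ j, (fun a => (x a j : ℂ)) ∈ S) (k : ι) : (fun a => (A (x a) k : ℂ)) ∈ S := by
  classical
  cases nonempty_fintype ι
  have hsum : (fun a => (A (x a) k : ℂ)) =
      ∑ j, (A (EuclideanSpace.single j 1) k : ℂ) • fun a => (x a j : ℂ) := by
    ext a
    conv_lhs => rw [← (EuclideanSpace.basisFun ι ℝ).sum_repr (x a)]
    simp only [map_sum, map_smul, EuclideanSpace.basisFun_apply, EuclideanSpace.basisFun_repr,
      WithLp.ofLp_sum, WithLp.ofLp_smul, Finset.sum_apply, Pi.smul_apply, smul_eq_mul,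
      Complex.ofReal_sum, Complex.ofReal_mul, mul_comm]
  rw [hsum]
  exact sum_mem fun j _ => S.smul_mem _ (hx j)

theorem interpolant_mem_trigSpan {ι : Type*} [Fintype ι] [DecidableEq ι] {N L : ℕ} (hL : 0 < L)
    (hN : 2 * (L - 1) < N) (u : ι → ℝ) (k : ι) :
    (fun φ => (interpolant L u 0 (L * π * sin φ) k : ℂ)) ∈ trigSpan N (L - 1) := by
  have hcardinal := clm_apply_mem_submodule (trigSpan N (L - 1)) (gramInv L u)
    (x := fun φ => shiftVec u (fejer L 0) (L * π * sin φ)) fun j => fejer_mem_trigSpan hL hN 0 (u j)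
  have hcorrection (j : ι) :
      (fun φ => (correction L u 0 (L * π * sin φ) j : ℂ)) ∈ trigSpan N (L - 1) := by
    convert sub_mem (fejer_mem_trigSpan hL hN 1 (u j))
      (clm_apply_mem_submodule _ (gram L 1 u) hcardinal j) using 1
    exact funext fun φ => Complex.ofReal_sub _ _
  convert sub_mem (hcardinal k) (clm_apply_mem_submodule _ (slopeOp L u) hcorrection k) using 1
  exact funext fun φ => Complex.ofReal_sub _ _

theorem norm_exp_two_pi (x : ℝ) (d : ℕ) :
    ‖Complex.exp (2 * π * Complex.I * (x : ℂ) * (d : ℂ))‖ = 1 := by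
  rw [show 2 * π * Complex.I * (x : ℂ) * (d : ℂ) = ((2 * π * x * d : ℝ) : ℂ) * Complex.I by
    push_cast; ring, Complex.norm_exp_ofReal_mul_I]

theorem norm_arrayResponse (n : ℕ) (θ : ℝ) (j : Fin n) : ‖arrayResponse n θ j‖ = 1 :=
  norm_exp_two_pi (sin θ) j

theorem arrayResponse_congr (n : ℕ) {φ θ : ℝ}
    (h : ((sin φ - sin θ : ℝ) : UnitAddCircle) = 0) : arrayResponse n φ = arrayResponse n θ := by
  obtain ⟨m, hm⟩ := (AddCircle.coe_eq_zero_iff _).1 h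
  rw [zsmul_one] at hm
  ext j
  rw [arrayResponse, arrayResponse, Complex.exp_eq_exp_iff_exists_int]
  refine ⟨m * j, ?_⟩
  rw [show sin φ = m + sin θ by linarith]
  push_cast
  ring

/-! ### Interpolating families of polynomials -/

/-- The property of the vectors `p k` to be coefficient vectors of polynomials in
`exp (2 π i sin φ)` that interpolate the Kronecker delta at the nodes `θ j` and have values in the
unit ball of `ℂ ^ K`, touching its boundary only at the nodes. -/
structure IsInterpolating {N K : ℕ} (θ : Fin K → ℝ) (p : Fin K → Fin N → ℂ) : Prop where
  apply_node (k j : Fin K) : p k ⬝ᵥ arrayResponse N (θ j) = if k = j then 1 else 0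
  sum_sq_le (φ : ℝ) : ∑ k, ‖p k ⬝ᵥ arrayResponse N φ‖ ^ 2 ≤ 1
  exists_node_of_sum_sq_eq (φ : ℝ) (h : ∑ k, ‖p k ⬝ᵥ arrayResponse N φ‖ ^ 2 = 1) :
    ∃ j, arrayResponse N φ = arrayResponse N (θ j)

theorem IsInterpolating.of_apply_node {N K : ℕ} {θ : Fin K → ℝ} {p : Fin K → Fin N → ℂ}
    (hnode : ∀ k j, p k ⬝ᵥ arrayResponse N (θ j) = if k = j then 1 else 0)
    (hlt : ∀ φ, (∃ j, arrayResponse N φ = arrayResponse N (θ j)) ∨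
      ∑ k, ‖p k ⬝ᵥ arrayResponse N φ‖ ^ 2 < 1) : IsInterpolating θ p where
  apply_node := hnode
  sum_sq_le φ := by
    rcases hlt φ with ⟨j, hj⟩ | h
    · simp [hj, hnode, apply_ite norm, ite_pow]
    · exact h.le
  exists_node_of_sum_sq_eq φ h := (hlt φ).resolve_right h.not_lt

theorem eq_or_norm_star_dotProduct_arrayResponse_lt {N : ℕ} (hN : 0 < N) (φ θ : ℝ) :
    arrayResponse N φ = arrayResponse N θ ∨
      ‖star (arrayResponse N θ) ⬝ᵥ arrayResponse N φ‖ < N := by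
  let e (φ : ℝ) : EuclideanSpace ℂ (Fin N) := WithLp.toLp 2 (arrayResponse N φ)
  have norm_e (φ : ℝ) : ‖e φ‖ = √N := by
    simp [e, EuclideanSpace.norm_eq, norm_arrayResponse]
  have e_ne_zero (φ : ℝ) : e φ ≠ 0 := by
    rw [← norm_ne_zero_iff, norm_e]
    positivity
  have hinner : star (arrayResponse N θ) ⬝ᵥ arrayResponse N φ = inner ℂ (e θ) (e φ) := by
    rw [EuclideanSpace.inner_eq_star_dotProduct, dotProduct_comm]
  have hprod : ‖e θ‖ * ‖e φ‖ = N := by rw [norm_e, norm_e, mul_self_sqrt N.cast_nonneg]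
  rw [hinner, ← hprod, or_iff_not_imp_right, not_lt]
  intro hle
  obtain ⟨c, -, hc⟩ := (norm_inner_eq_norm_iff (e_ne_zero θ) (e_ne_zero φ)).1
    ((norm_inner_le_norm _ _).antisymm hle)
  replace hc : arrayResponse N φ = c • arrayResponse N θ := congrArg WithLp.ofLp hc
  have hc₁ : c = 1 := by
    simpa [arrayResponse, eq_comm] using congrFun hc ⟨0, hN⟩
  rw [hc, hc₁, one_smul]

theorem star_dotProduct_arrayResponse_self (N : ℕ) (θ : ℝ) :
    star (arrayResponse N θ) ⬝ᵥ arrayResponse N θ = N := by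
  simp [dotProduct, Complex.conj_mul', norm_arrayResponse]

theorem exists_interpolating_one {N : ℕ} (hN : 0 < N) (θ : Fin 1 → ℝ) :
    ∃ p : Fin 1 → Fin N → ℂ, IsInterpolating θ p := by
  have hN₀ : (N : ℂ) ≠ 0 := by exact_mod_cast hN.ne'
  have hN₁ : (0 : ℝ) < N := by exact_mod_cast hN
  refine ⟨fun _ => (N : ℂ)⁻¹ • star (arrayResponse N (θ 0)), .of_apply_node (fun k j => ?_)
    fun φ => (eq_or_norm_star_dotProduct_arrayResponse_lt hN φ (θ 0)).imp (fun h => ⟨0, h⟩)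
      fun h => ?_⟩
  · rw [Subsingleton.elim j 0, if_pos (Subsingleton.elim _ _), smul_dotProduct,
      star_dotProduct_arrayResponse_self, smul_eq_mul, inv_mul_cancel₀ hN₀]
  · rw [Fin.sum_univ_one, smul_dotProduct, norm_smul, norm_inv, Complex.norm_natCast]
    refine pow_lt_one₀ (by positivity) ?_ two_ne_zero
    rwa [inv_mul_lt_iff₀ hN₁, mul_one]

theorem le_wrappedDist_of_separationThreshold_le {K N : ℕ} {θ : Fin K → ℝ}
    (h : separationThreshold N ≤ minSeparation θ) {i j : Fin K} (hij : i ≠ j) :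
    3 ≤ (N - 1) / 4 ∧
      119 / 100 / (((N - 1) / 4 : ℕ) : ℝ) ≤ wrappedDist (sin (θ i)) (sin (θ j)) := by
  have hdist : separationThreshold N ≤ ENNReal.ofReal (wrappedDist (sin (θ i)) (sin (θ j))) :=
    h.trans <| (iInf_le _ i).trans <| (iInf_le _ j).trans <| iInf_le _ hij
  rw [separationThreshold] at hdist
  generalize (N - 1) / 4 = m at hdist ⊢
  have hm : 0 < m := by
    refine Nat.pos_of_ne_zero fun hm => ?_
    rw [hm, Nat.cast_zero, ENNReal.div_zero (by simp; norm_num), top_le_iff] at hdist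
    exact ENNReal.ofReal_ne_top hdist
  have hm₀ : (0 : ℝ) < m := by exact_mod_cast hm
  rw [← ENNReal.ofReal_natCast, ← ENNReal.ofReal_div_of_pos hm₀,
    ENNReal.ofReal_le_ofReal_iff (by exact norm_nonneg _),
    show (1.19 : ℝ) = 119 / 100 by norm_num] at hdist
  refine ⟨?_, hdist⟩
  have hhalf : wrappedDist (sin (θ i)) (sin (θ j)) ≤ 1 / 2 := by
    simpa [wrappedDist] using
      AddCircle.norm_le_half_period 1 one_ne_zero
        (x := ((sin (θ i) - sin (θ j) : ℝ) : UnitAddCircle))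
  have h₂ := hdist.trans hhalf
  rw [div_le_iff₀ hm₀] at h₂
  exact_mod_cast (by linarith : (2 : ℝ) < m)

theorem norm_coe_mul_sub_mul (L : ℕ) (x y : ℝ) :
    ‖((L * π * x - L * π * y : ℝ) : AddCircle (π * L))‖ = L * π * wrappedDist x y := by
  have h := AddCircle.norm_coe_mul 1 (x - y) (L * π)
  rw [mul_one, abs_of_nonneg (by positivity), mul_sub] at h
  rw [mul_comm π, h, wrappedDist]

theorem exists_interpolating_of_separated {N K L : ℕ} (hL : 7 ≤ L) (hN : 2 * (L - 1) < N)
    {θ : Fin K → ℝ} (hθ : Separated L fun j => L * π * sin (θ j)) :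
    ∃ p : Fin K → Fin N → ℂ, IsInterpolating θ p := by
  have hL₀ : 0 < L := by omega
  choose q hq using interpolant_mem_trigSpan hL₀ hN fun j => L * π * sin (θ j)
  let w (φ : ℝ) : ℂ := Complex.exp (2 * π * Complex.I * (sin φ : ℂ) * ((L - 1 : ℕ) : ℂ))
  have norm_w (φ : ℝ) : ‖w φ‖ = 1 := norm_exp_two_pi (sin φ) (L - 1)
  have apply_p (k : Fin K) (φ : ℝ) : ((w (θ k))⁻¹ • q k) ⬝ᵥ arrayResponse N φ =
      (w (θ k))⁻¹ * (w φ * interpolant L (fun j => L * π * sin (θ j)) 0 (L * π * sin φ) k) := by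
    rw [smul_dotProduct, hq, smul_eq_mul]
  refine ⟨fun k => (w (θ k))⁻¹ • q k, .of_apply_node (fun k j => ?_) fun φ => ?_⟩
  · have hnode := hθ.interpolant_zero_node hL₀ j
    rw [apply_p, hnode, PiLp.single_apply]
    split_ifs with hkj
    · rw [hkj, Complex.ofReal_one, mul_one, inv_mul_cancel₀ (Complex.exp_ne_zero _)]
    · rw [Complex.ofReal_zero, mul_zero, mul_zero]
  · by_cases hφ : ∃ j, ((sin φ - sin (θ j) : ℝ) : UnitAddCircle) = 0
    · exact .inl (hφ.imp fun j hj => arrayResponse_congr N hj)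
    · refine .inr ?_
      have hlt := hθ.norm_interpolant_lt_one hL (v := L * π * sin φ) fun j hj => hφ ⟨j, ?_⟩
      · simp only [apply_p, norm_mul, norm_inv, norm_w, inv_one, one_mul, Complex.norm_real]
        rw [← EuclideanSpace.norm_sq_eq]
        exact pow_lt_one₀ (norm_nonneg _) hlt two_ne_zero
      · rw [← norm_eq_zero, norm_coe_mul_sub_mul] at hj
        exact norm_eq_zero.1 ((mul_eq_zero.1 hj).resolve_left (by positivity))

theorem exists_interpolating {N K : ℕ} (hN : 0 < N) (θ : Fin K → ℝ)
    (h : separationThreshold N ≤ minSeparation θ) :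
    ∃ p : Fin K → Fin N → ℂ, IsInterpolating θ p := by
  match K with
  | 0 => exact ⟨fun _ => 0, .of_apply_node (fun k => k.elim0) fun φ => .inr (by simp)⟩
  | 1 => exact exists_interpolating_one hN θ
  | K + 2 =>
    have hm : 3 ≤ (N - 1) / 4 :=
      (le_wrappedDist_of_separationThreshold_le h (i := 0) (j := 1) (by simp)).1
    refine exists_interpolating_of_separated (L := 2 * ((N - 1) / 4) + 1) (by omega) (by omega)
      fun i j hij => ?_
    have hdist := (le_wrappedDist_of_separationThreshold_le h hij).2
    generalize (N - 1) / 4 = m at hm hdist ⊢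
    have hm₀ : (0 : ℝ) < m := by positivity
    calc 238 / 100 * π ≤ ((2 * m + 1 : ℕ) : ℝ) * (119 / 100 / m) * π := by
          gcongr
          rw [mul_div_assoc', le_div_iff₀ hm₀]
          push_cast
          linarith
      _ = ((2 * m + 1 : ℕ) : ℝ) * π * (119 / 100 / m) := by ring
      _ ≤ ((2 * m + 1 : ℕ) : ℝ) * π * wrappedDist (sin (θ i)) (sin (θ j)) := by gcongr
      _ = _ := (norm_coe_mul_sub_mul _ _ _).symm

/-! ### Nonnegative trigonometric polynomials -/

section SumOfSquares

open Polynomial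

/-- The property of the trigonometric polynomial `z ^ (-n) * p z` to be real and nonnegative on the
unit circle, where `z ^ (-n)` is written `star z ^ n`. -/
def IsNonnegOnCircle (n : ℕ) (p : ℂ[X]) : Prop :=
  ∀ z : ℂ, ‖z‖ = 1 → 0 ≤ p.eval z * star z ^ n

theorem star_mul_self_of_norm_eq_one {z : ℂ} (hz : ‖z‖ = 1) : star z * z = 1 := by
  rw [Complex.star_def, Complex.conj_mul', hz, Complex.ofReal_one, one_pow]

theorem star_pow_ne_zero_of_norm_eq_one {z : ℂ} (hz : ‖z‖ = 1) (n : ℕ) : star z ^ n ≠ 0 :=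
  pow_ne_zero _ (left_ne_zero_of_mul_eq_one (star_mul_self_of_norm_eq_one hz))

theorem isPreconnected_unitCircle : IsPreconnected (Metric.sphere (0 : ℂ) 1) :=
  isPreconnected_sphere (by simp) 0 1

theorem nontrivial_unitCircle : (Metric.sphere (0 : ℂ) 1).Nontrivial :=
  ⟨1, by simp, -1, by simp, by norm_num⟩

theorem eq_zero_of_hasDerivAt_of_nonneg {g : ℝ → ℂ} {d : ℂ} {t : ℝ} (hg : ∀ s, 0 ≤ g s)
    (ht : g t = 0) (hd : HasDerivAt g d t) : d = 0 := by
  refine Complex.ext ?_ ?_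
  · have hre : HasDerivAt (fun s => (g s).re) d.re t :=
      Complex.reCLM.hasFDerivAt.comp_hasDerivAt t hd
    refine IsLocalMin.hasDerivAt_eq_zero (.of_forall fun s => ?_) hre
    rw [ht]
    exact (Complex.le_def.1 (hg s)).1
  · have him : HasDerivAt (fun s => (g s).im) d.im t :=
      Complex.imCLM.hasFDerivAt.comp_hasDerivAt t hd
    rw [funext fun s => (Complex.le_def.1 (hg s)).2.symm] at him
    exact him.unique (hasDerivAt_const t 0)

theorem IsNonnegOnCircle.isRoot_derivative {p : ℂ[X]} {n : ℕ} (hp : IsNonnegOnCircle n p) {z₀ : ℂ}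
    (hz₀ : ‖z₀‖ = 1) (hroot : p.IsRoot z₀) : p.derivative.IsRoot z₀ := by
  have hcircle : HasDerivAt (fun t : ℝ => z₀ * Complex.exp (t * Complex.I)) (z₀ * Complex.I) 0 := by
    simpa using ((Complex.ofRealCLM.hasDerivAt (x := 0)).mul_const Complex.I).cexp.const_mul z₀
  have hstart : z₀ * Complex.exp ((0 : ℝ) * Complex.I) = z₀ := by simp
  have heval : HasDerivAt (fun t : ℝ => p.eval (z₀ * Complex.exp (t * Complex.I)))
      (p.derivative.eval z₀ * (z₀ * Complex.I)) 0 :=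
    (p.hasDerivAt z₀).comp_of_eq 0 hcircle hstart.symm
  have hderiv := heval.fun_mul (hcircle.star.fun_pow n)
  rw [hstart, hroot.eq_zero, zero_mul, add_zero] at hderiv
  have hzero := eq_zero_of_hasDerivAt_of_nonneg
    (fun t => hp _ (by rw [norm_mul, hz₀, one_mul, Complex.norm_exp_ofReal_mul_I]))
    (by rw [hstart, hroot.eq_zero, zero_mul]) hderiv
  have hz₀' : z₀ * Complex.I ≠ 0 :=
    mul_ne_zero (norm_ne_zero_iff.1 (hz₀ ▸ one_ne_zero)) Complex.I_ne_zero
  exact (mul_eq_zero.1 ((mul_eq_zero.1 hzero).resolve_right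
    (star_pow_ne_zero_of_norm_eq_one hz₀ n))).resolve_right hz₀'

theorem IsNonnegOnCircle.of_ne {p : ℂ[X]} {n : ℕ} (z₀ : ℂ)
    (hp : ∀ z : ℂ, ‖z‖ = 1 → z ≠ z₀ → 0 ≤ p.eval z * star z ^ n) : IsNonnegOnCircle n p := by
  intro z hz
  by_cases hne : z = z₀
  · subst hne
    have hclosed : IsClosed {w : ℂ | 0 ≤ p.eval w * star w ^ n} :=
      isClosed_le continuous_const (by fun_prop)
    have hacc := isPreconnected_unitCircle.preperfect_of_nontrivial nontrivial_unitCircle z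
      (by simpa using hz)
    refine hclosed.closure_subset_iff.2 (fun w hw => ?_)
      (mem_closure_iff_clusterPt.2 (accPt_principal_iff_clusterPt.1 hacc))
    exact hp w (by simpa using hw.1) hw.2
  · exact hp z hz hne

theorem IsNonnegOnCircle.exists_eq_norm_sq_mul {p : ℂ[X]} {n : ℕ} (hp : IsNonnegOnCircle (n + 1) p)
    (hdeg : p.natDegree ≤ 2 * (n + 1)) {z₀ : ℂ} (hz₀ : ‖z₀‖ = 1) (hroot : p.IsRoot z₀) :
    ∃ q : ℂ[X], q.natDegree ≤ 2 * n ∧ IsNonnegOnCircle n q ∧ ∀ z : ℂ, ‖z‖ = 1 →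
      p.eval z * star z ^ (n + 1) = ((‖z - z₀‖ ^ 2 : ℝ) : ℂ) * (q.eval z * star z ^ n) := by
  rcases eq_or_ne p 0 with rfl | hp₀
  · exact ⟨0, by simp, fun z _ => by simp, fun z _ => by simp⟩
  obtain ⟨r, rfl⟩ : (X - C z₀) ^ 2 ∣ p := (le_rootMultiplicity_iff hp₀).1
    ((one_lt_rootMultiplicity_iff_isRoot hp₀).2 ⟨hroot, hp.isRoot_derivative hz₀ hroot⟩)
  have hfactor (z : ℂ) (hz : ‖z‖ = 1) : ((X - C z₀) ^ 2 * r).eval z * star z ^ (n + 1) =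
      ((‖z - z₀‖ ^ 2 : ℝ) : ℂ) * ((C (-z₀) * r).eval z * star z ^ n) := by
    have hnorm : ((‖z - z₀‖ ^ 2 : ℝ) : ℂ) = (star z - star z₀) * (z - z₀) := by
      rw [← star_sub, Complex.star_def, Complex.conj_mul', Complex.ofReal_pow]
    rw [hnorm]
    simp only [eval_mul, eval_pow, eval_sub, eval_X, eval_C, pow_succ]
    linear_combination ((z - z₀) * r.eval z * star z ^ n) *
      (star_mul_self_of_norm_eq_one hz - star_mul_self_of_norm_eq_one hz₀)
  refine ⟨C (-z₀) * r, ?_, .of_ne z₀ fun z hz hne => ?_, hfactor⟩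
  · have hr : r ≠ 0 := right_ne_zero_of_mul hp₀
    rw [natDegree_mul (pow_ne_zero _ (X_sub_C_ne_zero _)) hr, natDegree_pow,
      natDegree_X_sub_C] at hdeg
    exact (natDegree_C_mul_le _ _).trans (by omega)
  · have hprod := hp z hz
    rw [hfactor z hz] at hprod
    have hpos : (0 : ℂ) < ((‖z - z₀‖ ^ 2 : ℝ) : ℂ) :=
      Complex.zero_lt_real.2 (pow_pos (norm_pos_iff.2 (sub_ne_zero.2 hne)) 2)
    exact le_of_mul_le_mul_left (by rwa [mul_zero]) hpos

theorem eval_sub_C_mul_X_pow_mul_star_pow (p : ℂ[X]) (c : ℂ) (n : ℕ) {z : ℂ} (hz : ‖z‖ = 1) :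
    (p - C c * X ^ n).eval z * star z ^ n = p.eval z * star z ^ n - c := by
  rw [eval_sub, eval_mul, eval_C, eval_pow, eval_X, sub_mul, mul_assoc, ← mul_pow, mul_comm z,
    star_mul_self_of_norm_eq_one hz, one_pow, mul_one]

theorem IsNonnegOnCircle.exists_sub_isRoot {p : ℂ[X]} {n : ℕ} (hp : IsNonnegOnCircle n p) :
    ∃ c : ℝ, 0 ≤ c ∧ IsNonnegOnCircle n (p - C (c : ℂ) * X ^ n) ∧
      ∃ z₀ : ℂ, ‖z₀‖ = 1 ∧ (p - C (c : ℂ) * X ^ n).IsRoot z₀ := by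
  obtain ⟨z₀, hz₀, hmin⟩ := (isCompact_sphere (0 : ℂ) 1).exists_isMinOn
    nontrivial_unitCircle.nonempty (f := fun z => (p.eval z * star z ^ n).re)
    (Continuous.continuousOn (by fun_prop))
  replace hz₀ : ‖z₀‖ = 1 := by simpa using hz₀
  obtain ⟨hre, him⟩ := Complex.le_def.1 (hp z₀ hz₀)
  refine ⟨_, hre, fun z hz => ?_, z₀, hz₀, ?_⟩
  · rw [eval_sub_C_mul_X_pow_mul_star_pow _ _ _ hz, sub_nonneg, Complex.le_def]
    exact ⟨hmin (by simpa using hz), (Complex.le_def.1 (hp z hz)).2⟩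
  · refine (mul_eq_zero.1 ?_).resolve_right (star_pow_ne_zero_of_norm_eq_one hz₀ n)
    rw [eval_sub_C_mul_X_pow_mul_star_pow _ _ _ hz₀, sub_eq_zero]
    exact Complex.ext rfl him.symm

-- Weak form of the Fejér–Riesz theorem: several squares instead of one. Subtracting the minimum
-- produces a zero on the circle, which is double, so that a factor `‖z - z₀‖ ^ 2` splits off.
theorem IsNonnegOnCircle.exists_sum_sq {n : ℕ} {p : ℂ[X]} (hp : IsNonnegOnCircle n p)
    (hdeg : p.natDegree ≤ 2 * n) :
    ∃ l : List ℂ[X], (∀ h ∈ l, h.natDegree ≤ n) ∧ ∀ z : ℂ, ‖z‖ = 1 →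
      p.eval z * star z ^ n = (((l.map fun h => ‖h.eval z‖ ^ 2).sum : ℝ) : ℂ) := by
  induction n generalizing p with
  | zero =>
    obtain ⟨a, rfl⟩ := natDegree_eq_zero.1 (by omega : p.natDegree = 0)
    obtain ⟨r, hr, rfl⟩ := RCLike.nonneg_iff_exists_ofReal.1 (by simpa using hp 1 norm_one)
    exact ⟨[C (√r : ℂ)], by simp, fun z _ => by simp [sq_sqrt hr]⟩
  | succ n ih =>
    obtain ⟨c, hc, hnonneg, z₀, hz₀, hroot⟩ := hp.exists_sub_isRoot
    have hdeg' : (p - C (c : ℂ) * X ^ (n + 1)).natDegree ≤ 2 * (n + 1) :=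
      (natDegree_sub_le _ _).trans <| max_le hdeg <|
        (natDegree_C_mul_X_pow_le _ _).trans (by omega)
    obtain ⟨q, hq, hqnonneg, hfactor⟩ := hnonneg.exists_eq_norm_sq_mul hdeg' hz₀ hroot
    obtain ⟨l, hl, hsum⟩ := ih hqnonneg hq
    refine ⟨C (√c : ℂ) :: l.map ((X - C z₀) * ·), ?_, fun z hz => ?_⟩
    · simp only [List.forall_mem_cons, List.forall_mem_map, natDegree_C, zero_le, true_and]
      intro h hh
      refine natDegree_mul_le.trans ?_
      rw [natDegree_X_sub_C, add_comm]
      exact Nat.succ_le_succ (hl h hh)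
    · have hsplit := hfactor z hz
      rw [eval_sub_C_mul_X_pow_mul_star_pow _ _ _ hz, hsum z hz, sub_eq_iff_eq_add'] at hsplit
      rw [hsplit, List.map_cons, List.sum_cons, List.map_map, eval_C, Complex.norm_real,
        norm_of_nonneg (sqrt_nonneg c), sq_sqrt hc, Complex.ofReal_add, ← Complex.ofReal_mul,
        ← List.sum_map_mul_left]
      simp only [Function.comp_def, eval_mul, eval_sub, eval_X, eval_C, norm_mul, mul_pow]

end SumOfSquares

/-! ### Positive semidefinite Toeplitz matrices -/

section Toeplitz

open Polynomial
open scoped Matrix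

variable {n : ℕ}

/-- The entries of `toeplitz u`, listed by diagonals from the top right to the bottom left
corner. -/
def diagonalEntry (u : Fin n → ℂ) (l : ℕ) : ℂ :=
  if h : l < n then u ⟨n - 1 - l, by omega⟩
  else if h : l - (n - 1) < n then star (u ⟨l - (n - 1), h⟩) else 0

theorem toeplitz_apply (u : Fin n → ℂ) (i j : Fin n) :
    toeplitz u i j = diagonalEntry u (i + (n - 1 - j)) := by
  have hi := i.isLt
  have hj := j.isLt
  simp only [toeplitz, Matrix.of_apply, diagonalEntry]
  rcases le_or_gt i j with hij | hij
  · rw [if_pos hij, dif_pos (by omega)]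
    congr 2
    omega
  · rw [if_neg hij.not_ge, dif_neg (by omega), dif_pos (by omega)]
    congr 3
    omega

/-- The linear functional that sends `X ^ l` to the `l`-th diagonal entry of `toeplitz u`. Its
values on products `P(z) * conj P(z)` are those of the quadratic form of `toeplitz u`. -/
noncomputable def diagonalFunctional (u : Fin n → ℂ) : ℂ[X] →ₗ[ℂ] ℂ :=
  Polynomial.lsum fun l => LinearMap.mulRight ℂ (diagonalEntry u l)

theorem diagonalFunctional_C_mul_X_pow (u : Fin n → ℂ) (c : ℂ) (l : ℕ) :
    diagonalFunctional u (C c * X ^ l) = c * diagonalEntry u l := by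
  rw [C_mul_X_pow_eq_monomial, diagonalFunctional, lsum_apply,
    sum_monomial_index _ _ (LinearMap.map_zero _), LinearMap.mulRight_apply]

theorem diagonalFunctional_X_pow_pred (hn : 0 < n) (u : Fin n → ℂ) :
    diagonalFunctional u (X ^ (n - 1)) = u ⟨0, hn⟩ := by
  rw [← one_mul (X ^ (n - 1)), ← C_1, diagonalFunctional_C_mul_X_pow, one_mul, diagonalEntry,
    dif_pos (Nat.sub_lt hn one_pos)]
  simp only [Nat.sub_self]

theorem ofFn_eq_sum_C_mul_X_pow (p : Fin n → ℂ) : ofFn n p = ∑ i, C (p i) * X ^ (i : ℕ) := by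
  simp only [ofFn_eq_sum_monomial, C_mul_X_pow_eq_monomial]

/-- The polynomial that agrees with `z ^ (n - 1) * conj (P z)` on the unit circle, where `P` is
the polynomial with coefficient vector `p`. -/
noncomputable def conjReverse (p : Fin n → ℂ) : ℂ[X] :=
  ∑ i, C (star (p i)) * X ^ (n - 1 - i : ℕ)

theorem pow_mul_star_pow_of_norm_eq_one {z : ℂ} (hz : ‖z‖ = 1) (m : ℕ) :
    z ^ m * star z ^ m = 1 := by
  rw [← mul_pow, mul_comm, star_mul_self_of_norm_eq_one hz, one_pow]

theorem eval_conjReverse_mul_star_pow (p : Fin n → ℂ) {z : ℂ} (hz : ‖z‖ = 1) :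
    (conjReverse p).eval z * star z ^ (n - 1) = star ((ofFn n p).eval z) := by
  simp only [conjReverse, ofFn_eq_sum_C_mul_X_pow, eval_finsetSum, eval_mul, eval_C, eval_pow,
    eval_X, star_sum, star_mul', star_pow, sum_mul]
  refine sum_congr rfl fun i _ => ?_
  have hsplit : star z ^ (n - 1) = star z ^ (n - 1 - i : ℕ) * star z ^ (i : ℕ) := by
    rw [← pow_add]
    congr 1
    omega
  rw [hsplit, mul_assoc, ← mul_assoc (z ^ _), pow_mul_star_pow_of_norm_eq_one hz, one_mul]

theorem eval_mul_conjReverse_mul_star_pow (p : Fin n → ℂ) {z : ℂ} (hz : ‖z‖ = 1) :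
    (ofFn n p * conjReverse p).eval z * star z ^ (n - 1) =
      ((‖(ofFn n p).eval z‖ ^ 2 : ℝ) : ℂ) := by
  rw [eval_mul, mul_assoc, eval_conjReverse_mul_star_pow p hz, Complex.star_def,
    Complex.mul_conj', Complex.ofReal_pow]

theorem diagonalFunctional_mul_conjReverse (u p : Fin n → ℂ) :
    diagonalFunctional u (ofFn n p * conjReverse p) = p ⬝ᵥ toeplitz u *ᵥ star p := by
  rw [ofFn_eq_sum_C_mul_X_pow, conjReverse, sum_mul_sum]
  simp only [map_sum, dotProduct, Matrix.mulVec, mul_sum]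
  refine sum_congr rfl fun i _ => sum_congr rfl fun j _ => ?_
  rw [mul_mul_mul_comm, ← C_mul, ← pow_add, diagonalFunctional_C_mul_X_pow, toeplitz_apply,
    Pi.star_apply, mul_right_comm, mul_assoc]

theorem natDegree_mul_conjReverse_le (p : Fin n → ℂ) :
    (ofFn n p * conjReverse p).natDegree ≤ 2 * (n - 1) := by
  rw [ofFn_eq_sum_C_mul_X_pow, two_mul]
  exact natDegree_mul_le_of_le
    (natDegree_sum_le_of_forall_le _ _ fun i _ => (natDegree_C_mul_X_pow_le _ _).trans (by omega))
    (natDegree_sum_le_of_forall_le _ _ fun i _ => (natDegree_C_mul_X_pow_le _ _).trans (by omega))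

theorem IsNonnegOnCircle.exists_eq_sum_mul_conjReverse (hn : 0 < n) {q : ℂ[X]}
    (hq : IsNonnegOnCircle (n - 1) q) (hdeg : q.natDegree ≤ 2 * (n - 1)) :
    ∃ l : List (Fin n → ℂ), q = (l.map fun v => ofFn n v * conjReverse v).sum := by
  obtain ⟨l, hl, hsum⟩ := hq.exists_sum_sq hdeg
  refine ⟨l.map (toFn n), eq_of_infinite_eval_eq _ _ <|
    (isPreconnected_unitCircle.infinite_of_nontrivial nontrivial_unitCircle).mono fun z hz => ?_⟩
  replace hz : ‖z‖ = 1 := by simpa using hz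
  refine mul_right_cancel₀ (star_pow_ne_zero_of_norm_eq_one hz (n - 1)) ?_
  rw [hsum z hz, ← Complex.ofRealHom_eq_coe, map_list_sum, ← coe_evalRingHom, map_list_sum,
    ← List.sum_map_mul_right]
  simp only [List.map_map, Function.comp_def]
  refine congrArg List.sum (List.map_congr_left fun h hh => ?_)
  rw [coe_evalRingHom, eval_mul_conjReverse_mul_star_pow _ hz, Complex.ofRealHom_eq_coe,
    ofFn_comp_toFn_eq_id_of_natDegree_lt ((hl h hh).trans_lt (Nat.sub_lt hn one_pos))]

theorem diagonalFunctional_nonneg (hn : 0 < n) {u : Fin n → ℂ} (hu : (toeplitz u).PosSemidef)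
    {q : ℂ[X]} (hq : IsNonnegOnCircle (n - 1) q) (hdeg : q.natDegree ≤ 2 * (n - 1)) :
    0 ≤ diagonalFunctional u q := by
  obtain ⟨l, rfl⟩ := hq.exists_eq_sum_mul_conjReverse hn hdeg
  rw [map_list_sum, List.map_map]
  refine List.sum_nonneg (List.forall_mem_map.2 fun v _ => ?_)
  simpa only [Function.comp_apply, diagonalFunctional_mul_conjReverse, star_star] using
    hu.dotProduct_mulVec_nonneg (star v)

theorem exists_exp_sin_eq {z : ℂ} (hz : ‖z‖ = 1) :
    ∃ φ : ℝ, Complex.exp (2 * π * Complex.I * (sin φ : ℂ)) = z := by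
  have hpi := Real.pi_pos
  have hle : |z.arg / (2 * π)| ≤ 1 := by
    rw [abs_div, abs_of_pos (mul_pos two_pos hpi), div_le_one (mul_pos two_pos hpi)]
    linarith [Complex.abs_arg_le_pi z]
  have hexp := Complex.norm_mul_exp_arg_mul_I z
  rw [hz, Complex.ofReal_one, one_mul] at hexp
  refine ⟨arcsin (z.arg / (2 * π)), ?_⟩
  rw [sin_arcsin (abs_le.1 hle).1 (abs_le.1 hle).2]
  refine Eq.trans (congrArg Complex.exp ?_) hexp
  have hpi₀ : (π : ℂ) ≠ 0 := by exact_mod_cast hpi.ne'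
  push_cast
  field_simp

theorem dotProduct_arrayResponse (p : Fin n → ℂ) (φ : ℝ) :
    p ⬝ᵥ arrayResponse n φ =
      (ofFn n p).eval (Complex.exp (2 * π * Complex.I * (Real.sin φ : ℂ))) := by
  simp only [dotProduct, ofFn_eq_sum_C_mul_X_pow, eval_finsetSum, eval_mul, eval_C, eval_pow,
    eval_X, arrayResponse, ← Complex.exp_nat_mul]
  refine sum_congr rfl fun i _ => ?_
  rw [mul_comm ((i : ℕ) : ℂ)]

theorem isNonnegOnCircle_X_pow_sub_sum {ι : Type*} [Fintype ι] {p : ι → Fin n → ℂ}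
    (hp : ∀ φ, ∑ k, ‖p k ⬝ᵥ arrayResponse n φ‖ ^ 2 ≤ 1) :
    IsNonnegOnCircle (n - 1) (X ^ (n - 1) - ∑ k, ofFn n (p k) * conjReverse (p k)) := by
  intro z hz
  obtain ⟨φ, rfl⟩ := exists_exp_sin_eq hz
  simp only [eval_sub, eval_pow, eval_X, eval_finsetSum, sub_mul, sum_mul,
    pow_mul_star_pow_of_norm_eq_one hz, eval_mul_conjReverse_mul_star_pow _ hz,
    ← dotProduct_arrayResponse]
  exact_mod_cast sub_nonneg.2 (hp φ)

theorem sum_toeplitz_form_le {ι : Type*} [Fintype ι] (hn : 0 < n) {u : Fin n → ℂ}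
    (hu : (toeplitz u).PosSemidef) {p : ι → Fin n → ℂ}
    (hp : ∀ φ, ∑ k, ‖p k ⬝ᵥ arrayResponse n φ‖ ^ 2 ≤ 1) :
    ∑ k, p k ⬝ᵥ toeplitz u *ᵥ star (p k) ≤ u ⟨0, hn⟩ := by
  have hdeg : (X ^ (n - 1) - ∑ k, ofFn n (p k) * conjReverse (p k)).natDegree ≤ 2 * (n - 1) :=
    (natDegree_sub_le _ _).trans <| max_le ((natDegree_X_pow_le _).trans (by omega)) <|
      natDegree_sum_le_of_forall_le _ _ fun k _ => natDegree_mul_conjReverse_le (p k)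
  have hnonneg := diagonalFunctional_nonneg hn hu (isNonnegOnCircle_X_pow_sub_sum hp) hdeg
  simpa only [map_sub, map_sum, diagonalFunctional_mul_conjReverse,
    diagonalFunctional_X_pow_pred hn, sub_nonneg] using hnonneg

end Toeplitz

/-! ### The dual certificate -/

section Certificate

open scoped Matrix

variable {N M K L : ℕ} {X : Matrix (Fin N) (Fin M) ℂ} {s : Fin K → ℂ} {θ : Fin K → ℝ × ℝ}
  {c : Fin L → ℂ} {φ : Fin L → ℝ × ℝ} {p : Fin K → Fin N → ℂ} {r : Fin K → Fin M → ℂ}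

theorem pairing_atom (p : Fin N → ℂ) (r : Fin M → ℂ) (ψ : ℝ × ℝ) :
    p ⬝ᵥ atom N M ψ *ᵥ star r =
      (p ⬝ᵥ arrayResponse N ψ.1) * star (r ⬝ᵥ arrayResponse M ψ.2) := by
  rw [atom, Matrix.vecMulVec_mulVec, dotProduct_smul, MulOpposite.smul_eq_mul_unop,
    MulOpposite.unop_op, ← Matrix.star_dotProduct_star, dotProduct_comm (star _)]

theorem IsDecomposition.pairing_eq_sum (hc : IsDecomposition X c φ) (p : Fin N → ℂ)
    (r : Fin M → ℂ) : p ⬝ᵥ X *ᵥ star r = ∑ l, c l * (p ⬝ᵥ atom N M (φ l) *ᵥ star r) := by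
  simp only [hc.2, Matrix.sum_mulVec, dotProduct_sum, Matrix.smul_mulVec, dotProduct_smul,
    smul_eq_mul]

theorem pairing_atom_node (hp : IsInterpolating (fun k => (θ k).1) p)
    (hr : IsInterpolating (fun k => (θ k).2) r) (k j : Fin K) :
    p k ⬝ᵥ atom N M (θ j) *ᵥ star (r k) = if k = j then 1 else 0 := by
  rw [pairing_atom, hp.apply_node, hr.apply_node]
  split_ifs <;> simp

theorem pairing_eq_coefficient (hX : IsDecomposition X s θ)
    (hp : IsInterpolating (fun k => (θ k).1) p) (hr : IsInterpolating (fun k => (θ k).2) r)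
    (k : Fin K) : p k ⬝ᵥ X *ᵥ star (r k) = s k := by
  simp only [hX.pairing_eq_sum, pairing_atom_node hp hr, mul_ite, mul_one, mul_zero, sum_ite_eq,
    mem_univ, if_true]

/-- The dual certificate of a decomposition with coefficients `s`: the linear functional
`B ↦ ∑ k, v k * (p k ⬝ᵥ B *ᵥ conj (r k))` with the conjugate phases `v k = ‖s k‖ / s k`, which are
`0` where `s k = 0`. -/
noncomputable def certificate (p : Fin K → Fin N → ℂ) (r : Fin K → Fin M → ℂ) (s : Fin K → ℂ)
    (B : Matrix (Fin N) (Fin M) ℂ) : ℂ :=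
  ∑ k, (‖s k‖ / s k : ℂ) * (p k ⬝ᵥ B *ᵥ star (r k))

theorem norm_certificate_atom_le (p : Fin K → Fin N → ℂ) (r : Fin K → Fin M → ℂ)
    (s : Fin K → ℂ) (ψ : ℝ × ℝ) :
    ‖certificate p r s (atom N M ψ)‖ ≤ (∑ k, ‖p k ⬝ᵥ arrayResponse N ψ.1‖ ^ 2 +
      ∑ k, ‖r k ⬝ᵥ arrayResponse M ψ.2‖ ^ 2) / 2 := by
  rw [← sum_add_distrib, sum_div]
  refine norm_sum_le_of_le _ fun k _ => ?_
  set a := ‖p k ⬝ᵥ arrayResponse N ψ.1‖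
  set b := ‖r k ⬝ᵥ arrayResponse M ψ.2‖
  calc ‖(‖s k‖ / s k : ℂ) * (p k ⬝ᵥ atom N M ψ *ᵥ star (r k))‖
      = ‖s k‖ / ‖s k‖ * (a * b) := by
        rw [pairing_atom, norm_mul, norm_mul, norm_star, norm_div, Complex.norm_real, norm_norm]
    _ ≤ a * b := mul_le_of_le_one_left (by positivity) (div_self_le_one _)
    _ ≤ (a ^ 2 + b ^ 2) / 2 := by linarith [two_mul_le_add_sq a b]

theorem norm_certificate_atom_le_one (hp : IsInterpolating (fun k => (θ k).1) p)
    (hr : IsInterpolating (fun k => (θ k).2) r) (s : Fin K → ℂ) (ψ : ℝ × ℝ) :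
    ‖certificate p r s (atom N M ψ)‖ ≤ 1 := by
  linarith [norm_certificate_atom_le p r s ψ, hp.sum_sq_le ψ.1, hr.sum_sq_le ψ.2]

theorem exists_atom_eq_of_norm_certificate_atom (hp : IsInterpolating (fun k => (θ k).1) p)
    (hr : IsInterpolating (fun k => (θ k).2) r) {s : Fin K → ℂ} {ψ : ℝ × ℝ}
    (h : ‖certificate p r s (atom N M ψ)‖ = 1) :
    ∃ k, s k ≠ 0 ∧ atom N M ψ = atom N M (θ k) := by
  have hle := norm_certificate_atom_le p r s ψ
  obtain ⟨i, hi⟩ := hp.exists_node_of_sum_sq_eq ψ.1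
    (by linarith [hp.sum_sq_le ψ.1, hr.sum_sq_le ψ.2])
  obtain ⟨j, hj⟩ := hr.exists_node_of_sum_sq_eq ψ.2
    (by linarith [hp.sum_sq_le ψ.1, hr.sum_sq_le ψ.2])
  have hvalue : certificate p r s (atom N M ψ) = if i = j then (‖s i‖ / s i : ℂ) else 0 := by
    simp only [certificate, pairing_atom, hi, hj, hp.apply_node, hr.apply_node]
    rw [sum_eq_single i (fun k _ hk => by simp [hk]) (by simp), if_pos rfl]
    split_ifs <;> simp
  rw [hvalue] at h
  split_ifs at h with hij
  · refine ⟨i, fun hs => by simp [hs] at h, ?_⟩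
    rw [atom, atom, hi, hj, ← hij]
  · simp at h

theorem sum_mul_certificate_atom (hX : IsDecomposition X s θ)
    (hp : IsInterpolating (fun k => (θ k).1) p) (hr : IsInterpolating (fun k => (θ k).2) r)
    (hc : IsDecomposition X c φ) :
    ∑ l, c l * certificate p r s (atom N M (φ l)) = cost s := by
  simp only [certificate, mul_sum, cost, Complex.ofReal_sum]
  rw [sum_comm]
  refine sum_congr rfl fun k _ => ?_
  simp only [mul_left_comm (c _)]
  rw [← mul_sum, ← hc.pairing_eq_sum, pairing_eq_coefficient hX hp hr, div_mul_cancel_of_imp]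
  exact fun hs => by rw [hs, norm_zero, Complex.ofReal_zero]

theorem cost_le_sum_norm_certificate (hX : IsDecomposition X s θ)
    (hp : IsInterpolating (fun k => (θ k).1) p) (hr : IsInterpolating (fun k => (θ k).2) r)
    (hc : IsDecomposition X c φ) :
    cost s ≤ ∑ l, ‖c l‖ * ‖certificate p r s (atom N M (φ l))‖ :=
  calc cost s ≤ ‖(cost s : ℂ)‖ := by
        rw [Complex.norm_real]
        exact le_abs_self _
    _ ≤ ∑ l, ‖c l‖ * ‖certificate p r s (atom N M (φ l))‖ := by
        rw [← sum_mul_certificate_atom hX hp hr hc]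
        exact norm_sum_le_of_le _ fun l _ => norm_mul_le _ _

theorem atomicNorm_eq_cost (hX : IsDecomposition X s θ)
    (hp : IsInterpolating (fun k => (θ k).1) p) (hr : IsInterpolating (fun k => (θ k).2) r) :
    atomicNorm X = cost s := by
  refine IsLeast.csInf_eq ⟨⟨K, s, θ, hX, rfl⟩, ?_⟩
  rintro _ ⟨L, c, φ, hc, rfl⟩
  refine (cost_le_sum_norm_certificate hX hp hr hc).trans (sum_le_sum fun l _ => ?_)
  exact mul_le_of_le_one_right (norm_nonneg _) (norm_certificate_atom_le_one hp hr s _)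

theorem exists_atom_eq_of_optimal (hX : IsDecomposition X s θ)
    (hp : IsInterpolating (fun k => (θ k).1) p) (hr : IsInterpolating (fun k => (θ k).2) r)
    (hc : IsOptimalDecomposition X c φ) {l : Fin L} (hl : c l ≠ 0) :
    ∃ k, s k ≠ 0 ∧ atom N M (φ l) = atom N M (θ k) := by
  have hle : ∀ l ∈ univ, ‖c l‖ * ‖certificate p r s (atom N M (φ l))‖ ≤ ‖c l‖ := fun l _ =>
    mul_le_of_le_one_right (norm_nonneg _) (norm_certificate_atom_le_one hp hr s _)
  have hge : ∑ l, ‖c l‖ ≤ ∑ l, ‖c l‖ * ‖certificate p r s (atom N M (φ l))‖ := by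
    rw [← cost, hc.2, atomicNorm_eq_cost hX hp hr]
    exact cost_le_sum_norm_certificate hX hp hr hc.1
  have heq := (sum_eq_sum_iff_of_le hle).1 ((sum_le_sum hle).antisymm hge) l (mem_univ l)
  exact exists_atom_eq_of_norm_certificate_atom hp hr
    ((mul_eq_left₀ (norm_ne_zero_iff.2 hl)).1 heq)

theorem coefficientAt_eq_of_optimal (hX : IsDecomposition X s θ)
    (hp : IsInterpolating (fun k => (θ k).1) p) (hr : IsInterpolating (fun k => (θ k).2) r)
    (hc : IsOptimalDecomposition X c φ) (k : Fin K) :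
    coefficientAt c φ (atom N M (θ k)) = s k := by
  rw [← pairing_eq_coefficient hX hp hr k, hc.1.pairing_eq_sum, coefficientAt]
  refine sum_congr rfl fun l _ => ?_
  rcases eq_or_ne (c l) 0 with hl | hl
  · rw [hl, zero_mul, ite_self]
  obtain ⟨j, -, hj⟩ := exists_atom_eq_of_optimal hX hp hr hc hl
  have hatom : atom N M (φ l) = atom N M (θ k) ↔ k = j := by
    refine ⟨fun h => ?_, fun h => by rw [hj, h]⟩
    have hpair := pairing_atom_node hp hr k k
    rw [← h, hj, pairing_atom_node hp hr, if_pos rfl] at hpair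
    exact by_contra fun hkj => one_ne_zero (hpair.symm.trans (if_neg hkj))
  simp only [hatom]
  rw [hj, pairing_atom_node hp hr, mul_ite, mul_one, mul_zero]

end Certificate

/-! ### The semidefinite program -/

section SDP

open scoped Matrix

theorem two_mul_norm_le_of_posSemidef_fromBlocks {m n : Type*} [Fintype m] [Fintype n]
    {A : Matrix m m ℂ} {B : Matrix n n ℂ} {X : Matrix n m ℂ}
    (h : (Matrix.fromBlocks A Xᴴ X B).PosSemidef) (x : m → ℂ) (y : n → ℂ) :
    2 * ‖star y ⬝ᵥ X *ᵥ x‖ ≤ (star x ⬝ᵥ A *ᵥ x).re + (star y ⬝ᵥ B *ᵥ y).re := by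
  obtain ⟨c, hc, hcz⟩ := RCLike.exists_norm_eq_mul_self (star y ⬝ᵥ X *ᵥ x)
  have hlower : star (-star c • y) ⬝ᵥ X *ᵥ x = ((-‖star y ⬝ᵥ X *ᵥ x‖ : ℝ) : ℂ) := by
    rw [star_smul, star_neg, star_star, smul_dotProduct, smul_eq_mul, neg_mul, ← hcz]
    exact (Complex.ofReal_neg _).symm
  have hupper : star x ⬝ᵥ Xᴴ *ᵥ (-star c • y) = ((-‖star y ⬝ᵥ X *ᵥ x‖ : ℝ) : ℂ) := by
    rw [← Complex.conj_ofReal, ← hlower, ← Complex.star_def,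
      Matrix.star_dotProduct _ (X *ᵥ x), star_star, Matrix.star_mulVec, Matrix.dotProduct_mulVec]
  have hdiag : star (-star c • y) ⬝ᵥ B *ᵥ (-star c • y) = star y ⬝ᵥ B *ᵥ y := by
    rw [Matrix.mulVec_smul, star_smul, smul_dotProduct, dotProduct_smul, smul_smul, star_neg,
      neg_mul_neg, star_mul_self_of_norm_eq_one ((norm_star c).trans hc), one_smul]
  have hform := h.dotProduct_mulVec_nonneg (Sum.elim x (-star c • y))
  rw [Function.star_sumElim, Matrix.fromBlocks_mulVec, sumElim_dotProduct_sumElim,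
    Sum.elim_comp_inl, Sum.elim_comp_inr, dotProduct_add, dotProduct_add, hlower, hupper,
    hdiag] at hform
  have hre := (Complex.le_def.1 hform).1
  simp only [Complex.zero_re, Complex.add_re, Complex.ofReal_re] at hre
  linarith

theorem two_mul_mul_norm_le_of_posSemidef_fromBlocks {m n : Type*} [Fintype m] [Fintype n]
    {A : Matrix m m ℂ} {B : Matrix n n ℂ} {X : Matrix n m ℂ}
    (h : (Matrix.fromBlocks A Xᴴ X B).PosSemidef) (x : m → ℂ) (y : n → ℂ) (a b : ℝ) :
    2 * (a * b) * ‖star y ⬝ᵥ X *ᵥ x‖ ≤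
      b ^ 2 * (star x ⬝ᵥ A *ᵥ x).re + a ^ 2 * (star y ⬝ᵥ B *ᵥ y).re := by
  have hform := two_mul_norm_le_of_posSemidef_fromBlocks h ((b : ℂ) • x) ((a : ℂ) • y)
  simp only [star_smul, Complex.star_def, Complex.conj_ofReal, Matrix.mulVec_smul,
    smul_dotProduct, dotProduct_smul, smul_eq_mul, norm_mul, Complex.norm_real,
    Complex.re_ofReal_mul, norm_eq_abs] at hform
  calc 2 * (a * b) * ‖star y ⬝ᵥ X *ᵥ x‖ ≤ 2 * (|a| * |b|) * ‖star y ⬝ᵥ X *ᵥ x‖ := by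
        rw [← abs_mul]
        gcongr
        exact le_abs_self _
    _ ≤ _ := by linarith

variable {N M K : ℕ} {X : Matrix (Fin N) (Fin M) ℂ} {s : Fin K → ℂ} {θ : Fin K → ℝ × ℝ}

theorem trace_toeplitz {n : ℕ} (hn : 0 < n) (u : Fin n → ℂ) :
    (toeplitz u).trace = n * u ⟨0, hn⟩ := by
  have hdiag (i : Fin n) : toeplitz u i i = u ⟨0, hn⟩ := by simp [toeplitz]
  simp only [Matrix.trace, Matrix.diag_apply, hdiag, sum_const, card_univ, Fintype.card_fin,
    nsmul_eq_mul]

theorem sdpObjective_eq (hN : 0 < N) (hM : 0 < M) (ux : Fin N → ℂ) (uy : Fin M → ℂ) :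
    sdpObjective ux uy =
      (N * (ux ⟨0, hN⟩).re + M * (uy ⟨0, hM⟩).re) / (2 * (√N * √M)) := by
  rw [sdpObjective, trace_toeplitz hN, trace_toeplitz hM, sqrt_mul N.cast_nonneg,
    ← Complex.ofReal_natCast, ← Complex.ofReal_natCast, Complex.re_ofReal_mul,
    Complex.re_ofReal_mul, one_div_mul_eq_div]

theorem cost_le_sdpObjective (hN : 0 < N) (hM : 0 < M) {p : Fin K → Fin N → ℂ}
    {r : Fin K → Fin M → ℂ} (hX : IsDecomposition X s θ)
    (hp : IsInterpolating (fun k => (θ k).1) p) (hr : IsInterpolating (fun k => (θ k).2) r)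
    {ux : Fin N → ℂ} {uy : Fin M → ℂ} (h : SDPFeasible X ux uy) :
    cost s ≤ sdpObjective ux uy := by
  have hTx : (toeplitz ux).PosSemidef := Matrix.PosSemidef.submatrix h Sum.inr
  have hTy : (toeplitz uy).PosSemidef := Matrix.PosSemidef.submatrix h Sum.inl
  have hsx := (Complex.le_def.1 (sum_toeplitz_form_le hN hTx hp.sum_sq_le)).1
  have hsy := (Complex.le_def.1 (sum_toeplitz_form_le hM hTy hr.sum_sq_le)).1
  rw [Complex.re_sum] at hsx hsy
  have hk (k : Fin K) : 2 * (√N * √M) * ‖s k‖ ≤ M * (r k ⬝ᵥ toeplitz uy *ᵥ star (r k)).re +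
      N * (p k ⬝ᵥ toeplitz ux *ᵥ star (p k)).re := by
    have hblock := two_mul_mul_norm_le_of_posSemidef_fromBlocks h (star (r k)) (star (p k)) √N √M
    rwa [star_star, star_star, pairing_eq_coefficient hX hp hr, sq_sqrt N.cast_nonneg,
      sq_sqrt M.cast_nonneg] at hblock
  rw [sdpObjective_eq hN hM, le_div_iff₀ (by positivity)]
  calc cost s * (2 * (√N * √M)) = ∑ k, 2 * (√N * √M) * ‖s k‖ := by rw [mul_comm, cost, mul_sum]
    _ ≤ ∑ k, (M * (r k ⬝ᵥ toeplitz uy *ᵥ star (r k)).re +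
          N * (p k ⬝ᵥ toeplitz ux *ᵥ star (p k)).re) := sum_le_sum fun k _ => hk k
    _ = M * ∑ k, (r k ⬝ᵥ toeplitz uy *ᵥ star (r k)).re +
          N * ∑ k, (p k ⬝ᵥ toeplitz ux *ᵥ star (p k)).re := by
        rw [sum_add_distrib, mul_sum, mul_sum]
    _ ≤ M * (uy ⟨0, hM⟩).re + N * (ux ⟨0, hN⟩).re := by gcongr
    _ = N * (ux ⟨0, hN⟩).re + M * (uy ⟨0, hM⟩).re := add_comm _ _

theorem arrayResponse_mul_star {n : ℕ} (θ : ℝ) {i j : Fin n} (hij : i ≤ j) :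
    arrayResponse n θ i * star (arrayResponse n θ j) =
      star (arrayResponse n θ ⟨(j : ℕ) - i, lt_of_le_of_lt (Nat.sub_le _ _) j.isLt⟩) := by
  have hsplit : arrayResponse n θ j = arrayResponse n θ i *
      arrayResponse n θ ⟨(j : ℕ) - i, lt_of_le_of_lt (Nat.sub_le _ _) j.isLt⟩ := by
    simp only [arrayResponse]
    rw [← Complex.exp_add, Nat.cast_sub hij, ← mul_add, add_sub_cancel]
  rw [hsplit, star_mul', ← mul_assoc, mul_comm (arrayResponse n θ i),
    star_mul_self_of_norm_eq_one (norm_arrayResponse n θ i), one_mul]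

theorem toeplitz_sum_arrayResponse {n : ℕ} {ι : Type*} [Fintype ι] (c θ : ι → ℝ) :
    toeplitz (fun j : Fin n => ∑ k, (c k : ℂ) * star (arrayResponse n (θ k) j)) =
      ∑ k, (c k : ℂ) • Matrix.vecMulVec (arrayResponse n (θ k))
        (star (arrayResponse n (θ k))) := by
  ext i j
  simp only [Matrix.sum_apply, Matrix.smul_apply, Matrix.vecMulVec_apply, Pi.star_apply,
    smul_eq_mul, toeplitz, Matrix.of_apply]
  split_ifs with hij
  · simp only [arrayResponse_mul_star _ hij]
  · rw [star_sum]
    refine sum_congr rfl fun k _ => ?_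
    rw [← arrayResponse_mul_star _ (not_le.1 hij).le, star_mul', star_mul', star_star,
      Complex.star_def, Complex.conj_ofReal, mul_comm (arrayResponse n (θ k) i)]

theorem IsDecomposition.sdpFeasible_sum (hX : IsDecomposition X s θ) {x y : Fin K → ℂ}
    (hxy : ∀ k, y k * star (x k) = s k) :
    SDPFeasible X (fun j => ∑ k, ((‖y k‖ ^ 2 : ℝ) : ℂ) * star (arrayResponse N (θ k).1 j))
      (fun j => ∑ k, ((‖x k‖ ^ 2 : ℝ) : ℂ) * star (arrayResponse M (θ k).2 j)) := by
  let w (k : Fin K) : Fin M ⊕ Fin N → ℂ :=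
    Sum.elim (x k • arrayResponse M (θ k).2) (y k • arrayResponse N (θ k).1)
  suffices hw : Matrix.fromBlocks _ Xᴴ X _ = ∑ k, Matrix.vecMulVec (w k) (star (w k)) by
    rw [SDPFeasible, hw]
    exact Matrix.posSemidef_sum _ fun k _ => Matrix.posSemidef_vecMulVec_self_star _
  have hsq (z : ℂ) : ((‖z‖ ^ 2 : ℝ) : ℂ) = z * star z := by
    rw [Complex.star_def, Complex.mul_conj', Complex.ofReal_pow]
  rw [toeplitz_sum_arrayResponse _ fun k => (θ k).1, toeplitz_sum_arrayResponse _ fun k => (θ k).2,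
    hX.2]
  ext (i | i) (j | j) <;>
  · simp only [Matrix.fromBlocks_apply₁₁, Matrix.fromBlocks_apply₁₂, Matrix.fromBlocks_apply₂₁,
      Matrix.fromBlocks_apply₂₂, Matrix.conjTranspose_apply, Matrix.sum_apply, Matrix.smul_apply,
      Matrix.vecMulVec_apply, Pi.star_apply, Pi.smul_apply, Sum.elim_inl, Sum.elim_inr, atom, w,
      hsq, ← hxy, smul_eq_mul, star_sum, star_mul', star_star]
    exact sum_congr rfl fun k _ => by ring

theorem exists_mul_star_eq (s : ℂ) {t : ℝ} (ht : 0 < t) :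
    ∃ x y : ℂ, y * star x = s ∧ ‖x‖ ^ 2 = ‖s‖ * t ∧ ‖y‖ ^ 2 = ‖s‖ / t := by
  have hx : ‖(√(‖s‖ * t) : ℂ)‖ ^ 2 = ‖s‖ * t := by
    rw [Complex.norm_real, norm_of_nonneg (sqrt_nonneg _), sq_sqrt (by positivity)]
  rcases eq_or_ne s 0 with rfl | hs
  · exact ⟨0, 0, by simp⟩
  have hs₀ : ‖s‖ ≠ 0 := norm_ne_zero_iff.2 hs
  have hx₀ : (√(‖s‖ * t) : ℂ) ≠ 0 := Complex.ofReal_ne_zero.2 (by positivity)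
  refine ⟨√(‖s‖ * t), s / √(‖s‖ * t), ?_, hx, ?_⟩
  · rw [Complex.star_def, Complex.conj_ofReal, div_mul_cancel₀ _ hx₀]
  · rw [norm_div, div_pow, hx]
    field_simp

theorem exists_feasible (hN : 0 < N) (hM : 0 < M) (hX : IsDecomposition X s θ) :
    ∃ (ux : Fin N → ℂ) (uy : Fin M → ℂ), SDPFeasible X ux uy ∧
      cost s = sdpObjective ux uy := by
  have hN₀ : 0 < √(N : ℝ) := by positivity
  have hM₀ : 0 < √(M : ℝ) := by positivity
  choose x y hxy hx hy using fun k => exists_mul_star_eq (s k) (div_pos hN₀ hM₀)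
  refine ⟨_, _, hX.sdpFeasible_sum hxy, ?_⟩
  have arrayResponse_zero (n : ℕ) (hn : 0 < n) (ψ : ℝ) : arrayResponse n ψ ⟨0, hn⟩ = 1 := by
    simp [arrayResponse]
  rw [sdpObjective_eq hN hM]
  simp only [arrayResponse_zero, star_one, mul_one, hx, hy, ← Complex.ofReal_sum,
    Complex.ofReal_re, ← sum_mul, ← sum_div, cost]
  field_simp
  rw [sq_sqrt N.cast_nonneg, sq_sqrt M.cast_nonneg]
  ring

end SDP

end DecoupledANM

theorem theorem1 (N M K : ℕ) (hN : 0 < N) (hM : 0 < M)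
    (X : Matrix (Fin N) (Fin M) ℂ) (s : Fin K → ℂ) (θ : Fin K → ℝ × ℝ)
    (hX : DecoupledANM.IsDecomposition X s θ)
    (hx : DecoupledANM.minSeparation (fun k => (θ k).1) ≥ DecoupledANM.separationThreshold N)
    (hy : DecoupledANM.minSeparation (fun k => (θ k).2) ≥ DecoupledANM.separationThreshold M) :
    -- the given decomposition is optimal
    DecoupledANM.IsOptimalDecomposition X s θ ∧
    -- it is the only optimal one: every optimal decomposition uses, with nonzero coefficients,
    -- only atoms of the given one, and its total coefficient at the `k`-th atom is `s k`
    (∀ (L : ℕ) (c : Fin L → ℂ) (φ : Fin L → ℝ × ℝ),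
      DecoupledANM.IsOptimalDecomposition X c φ →
        (∀ l, c l ≠ 0 → ∃ k, s k ≠ 0 ∧
          DecoupledANM.atom N M (φ l) = DecoupledANM.atom N M (θ k)) ∧
        ∀ k, DecoupledANM.coefficientAt c φ (DecoupledANM.atom N M (θ k)) = s k) ∧
    -- the atomic norm is the (attained) minimum of the semidefinite program
    IsLeast {r : ℝ | ∃ (ux : Fin N → ℂ) (uy : Fin M → ℂ),
        DecoupledANM.SDPFeasible X ux uy ∧ r = DecoupledANM.sdpObjective ux uy}
      (DecoupledANM.atomicNorm X) := by
  obtain ⟨p, hp⟩ := DecoupledANM.exists_interpolating hN (fun k => (θ k).1) hx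
  obtain ⟨r, hr⟩ := DecoupledANM.exists_interpolating hM (fun k => (θ k).2) hy
  have hnorm := DecoupledANM.atomicNorm_eq_cost hX hp hr
  refine ⟨⟨hX, hnorm.symm⟩, fun L c φ hc =>
    ⟨fun l hl => DecoupledANM.exists_atom_eq_of_optimal hX hp hr hc hl,
      DecoupledANM.coefficientAt_eq_of_optimal hX hp hr hc⟩, ?_, ?_⟩
  · rw [hnorm]
    exact DecoupledANM.exists_feasible hN hM hX
  · rintro _ ⟨ux, uy, h, rfl⟩
    rw [hnorm]
    exact DecoupledANM.cost_le_sdpObjective hN hM hX hp hr h
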